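/- Let $m \ge 2$ be an integer and let $p$ be an odd prime. Let $F$ be the field with $p$ elements, let $V$ and $W$ be vector spaces over $F$ of dimensions $2$ and $m$, and let $\{e_1,e_2\}$ be a basis of $V$. Let $D_8 \le \mathrm{GL}(V)$ be the group generated by the two linear transformations whose matrices with respect to $\{e_1,e_2\}$ are $$\begin{bmatrix} 1 & 0 \\ 0 & -1 \end{bmatrix} \quad\text{and}\quad \begin{bmatrix} 0 & 1 \\ 1 & 0 \end{bmatrix}.$$ For $a \in \mathrm{GL}(V)$ and $g \in \mathrm{GL}(W)$ let $a \circ g$ denote the linear transformation of $V \otimes W$ that maps $v \otimes w$ to $a(v) \otimes g(w)$, and let $D_8 \circ \mathrm{GL}(W) = \{a \circ g : a \in D_8,\ g \in \mathrm{GL}(W)\}$. Let $$G(m,p) = (V \otimes W) \rtimes (D_8 \circ \mathrm{GL}(W)),$$ the group of all permutations $x \mapsto \theta(x) + c$ of $V \otimes W$ with $\theta \in D_8 \circ \mathrm{GL}(W)$ and $c \in V \otimes W$. The orbitals of a permutation group $H$ on a set $\Omega$ are its orbits on $\Omega \times \Omega$. The $2$-closure of $H$ is the largest permutation group on $\Omega$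 with the same orbitals as $H$, and $H$ is $2$-closed if it equals its $2$-closure. The group $H$ is regular if it is transitive and all its point stabilisers are trivial, and nonregular otherwise. A digraph on $\Omega$ is given by a set of arcs in $\Omega \times \Omega$ that contains no pair $(v,v)$. Then the following two statements are equivalent: 1. $G(m,p)$ is $2$-closed, is nonregular, and is not the automorphism group of any digraph on $V \otimes W$; 2. $p \in \{3,5,7,13\}$. -/

import Mathlib

open scoped TensorProduct

section PermutationGroups

variable {Ω : Type*}

/-- The orbitals of a permutation group `G` on `Ω`: the orbits of `G` on `Ω × Ω`. -/
def orbitals (G : Subgroup (Equiv.Perm Ω)) : Set (Set (Ω × Ω)) :=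
  {B | ∃ z : Ω × Ω, B = MulAction.orbit G z}

/-- The `2`-closure of a permutation group `G`: the group of all permutations that map every pair
to a pair in the same orbital of `G`. By `isGreatest_twoClosure` below it is the largest
permutation group with the same orbitals as `G`. -/
def twoClosure (G : Subgroup (Equiv.Perm Ω)) : Subgroup (Equiv.Perm Ω) where
  carrier := {σ | ∀ z : Ω × Ω, σ • z ∈ MulAction.orbit G z}
  one_mem' z := by simp
  mul_mem' {σ τ} hσ hτ z := by
    have h := hσ (τ • z)
    rw [MulAction.orbit_eq_iff.2 (hτ z)] at h
    rwa [mul_smul]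
  inv_mem' {σ} hσ z := by
    have h := hσ (σ⁻¹ • z)
    rw [smul_inv_smul] at h
    exact MulAction.mem_orbit_symm.1 h

theorem isGreatest_twoClosure (G : Subgroup (Equiv.Perm Ω)) :
    IsGreatest {H : Subgroup (Equiv.Perm Ω) | orbitals H = orbitals G} (twoClosure G) := by
  have key : ∀ z : Ω × Ω, MulAction.orbit (twoClosure G) z = MulAction.orbit G z := by
    intro z
    apply Set.Subset.antisymm
    · rintro _ ⟨σ, rfl⟩
      exact σ.2 z
    · rintro _ ⟨σ, rfl⟩
      exact ⟨⟨σ.1, fun w => ⟨σ, rfl⟩⟩, rfl⟩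
  refine ⟨show orbitals (twoClosure G) = orbitals G by simp only [orbitals, key], ?_⟩
  intro H hH σ hσ z
  have hz : MulAction.orbit H z ∈ orbitals G := by
    rw [← (show orbitals H = orbitals G from hH)]
    exact ⟨z, rfl⟩
  obtain ⟨w, hw⟩ := hz
  have h1 : z ∈ MulAction.orbit G w := hw ▸ MulAction.mem_orbit_self z
  have h2 : σ • z ∈ MulAction.orbit G w := hw ▸ ⟨⟨σ, hσ⟩, rfl⟩
  rwa [MulAction.orbit_eq_iff.2 h1]

/-- A permutation group is `2`-closed if it is equal to its `2`-closure. -/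
def IsTwoClosed (G : Subgroup (Equiv.Perm Ω)) : Prop :=
  twoClosure G = G

/-- A permutation group is regular if it is transitive and all its point stabilisers are
trivial. -/
def IsRegularPermGroup (G : Subgroup (Equiv.Perm Ω)) : Prop :=
  MulAction.IsPretransitive G Ω ∧ ∀ x : Ω, MulAction.stabilizer G x = ⊥

/-- The automorphism group of a digraph, as a group of permutations of its vertices. -/
def digraphAut (Γ : Digraph Ω) : Subgroup (Equiv.Perm Ω) where
  carrier := {σ | ∀ x y : Ω, Γ.Adj (σ x) (σ y) ↔ Γ.Adj x y}
  one_mem' x y := Iff.rfl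
  mul_mem' {σ τ} hσ hτ x y := (hσ (τ x) (τ y)).trans (hτ x y)
  inv_mem' {σ} hσ x y := by
    have h := hσ (σ⁻¹ x) (σ⁻¹ y)
    rw [← Equiv.Perm.mul_apply, ← Equiv.Perm.mul_apply, mul_inv_cancel] at h
    exact h.symm

/-- `G` is the automorphism group of some digraph without loops. -/
def IsDigraphAut (G : Subgroup (Equiv.Perm Ω)) : Prop :=
  ∃ Γ : Digraph Ω, (∀ x : Ω, ¬ Γ.Adj x x) ∧ digraphAut Γ = G

end PermutationGroups

section AffineGroup

variable {F V : Type*} [Field F] [AddCommGroup V] [Module F V]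

/-- The group of linear transformations of `V` generated by the two whose matrices with respect to
the basis `e` are `diag(1, -1)` and the permutation matrix swapping the basis vectors (it is
dihedral of order `8` when the characteristic of `F` is not `2`). -/
def dihedralD8 (e : Module.Basis (Fin 2) F V) : Subgroup (V ≃ₗ[F] V) :=
  Subgroup.closure
    {a | LinearMap.toMatrix e e (a : V →ₗ[F] V) = !![1, 0; 0, -1] ∨
      LinearMap.toMatrix e e (a : V →ₗ[F] V) = !![0, 1; 1, 0]}

variable (e : Module.Basis (Fin 2) F V) (W : Type*) [AddCommGroup W] [Module F W]

/-- The group `D₈ ∘ GL(W)` of all linear transformations `a ∘ g` of `V ⊗ W`, with `a ∈ D₈` and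
`g ∈ GL(W)`, where `a ∘ g` maps `v ⊗ w` to `a v ⊗ g w`. -/
def pointGroup : Subgroup ((V ⊗[F] W) ≃ₗ[F] (V ⊗[F] W)) where
  carrier := {θ | ∃ a ∈ dihedralD8 e, ∃ g : W ≃ₗ[F] W, θ = TensorProduct.congr a g}
  one_mem' := ⟨1, one_mem _, 1, by
    apply LinearEquiv.toLinearMap_injective
    ext v w
    simp⟩
  mul_mem' := by
    rintro _ _ ⟨a, ha, g, rfl⟩ ⟨b, hb, h, rfl⟩
    refine ⟨a * b, mul_mem ha hb, g * h, ?_⟩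
    apply LinearEquiv.toLinearMap_injective
    ext v w
    simp
  inv_mem' := by
    rintro _ ⟨a, ha, g, rfl⟩
    refine ⟨a⁻¹, inv_mem ha, g⁻¹, ?_⟩
    rw [inv_eq_iff_mul_eq_one]
    apply LinearEquiv.toLinearMap_injective
    ext v w
    simp

/-- The affine group `(V ⊗ W) ⋊ (D₈ ∘ GL(W))`, as a permutation group on `V ⊗ W`: the group of all
maps `x ↦ θ x + c` with `θ ∈ D₈ ∘ GL(W)` and `c ∈ V ⊗ W`. For `F = GF(q)` and `dim W = m` this is
the group `G(m, q)`. -/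
def affineGroupG : Subgroup (Equiv.Perm (V ⊗[F] W)) where
  carrier := {σ | ∃ θ ∈ pointGroup e W, ∃ c : V ⊗[F] W, ∀ x, σ x = θ x + c}
  one_mem' := ⟨1, one_mem _, 0, by simp⟩
  mul_mem' := by
    rintro σ τ ⟨θ, hθ, c, hσ⟩ ⟨η, hη, d, hτ⟩
    refine ⟨θ * η, mul_mem hθ hη, θ d + c, fun x => ?_⟩
    simp [hσ, hτ, add_assoc]
  inv_mem' := by
    rintro σ ⟨θ, hθ, c, hσ⟩
    refine ⟨θ⁻¹, inv_mem hθ, -(θ⁻¹ c), fun x => ?_⟩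
    rw [Equiv.Perm.inv_eq_iff_eq, hσ]
    simp [← map_neg, ← map_add]

end AffineGroup

/-! A basis of `V` identifies `V ⊗ W` with `W × W`, and `G(m,p)` becomes the group of monomial
affine maps `(x, y) ↦ (g x, ± g y) + c` and `(x, y) ↦ (g y, ± g x) + c`. It contains negation, which
fixes `0`, so it is not regular.

The main tool is a net lemma. Join two points of `W × W` when their difference lies in one of a few
subspaces `v ⊗ W`. Three points on a line have the whole line as common neighbours, but three points
not on a line have only boundedly many. If lines are long compared with the number of parallel
classes, a permutation preserving the relation therefore permutes the classes. Applied to the two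
coordinate classes (`exists_map_netClass`), this shows that an element of the 2-closure acts
separately on the two coordinates, up to exchanging them. The invariant relation `x - x' = ±(y -
y')` then makes the two actions additive and equal up to sign, so the group is 2-closed.

With at least three classes the permutation is `M ⊗ f` plus a translation, where `M` permutes the
chosen points of the projective line (`exists_matrix_of_map_netClass`). Hence `G(m,p)` is a digraph
group as soon as some `D₈`-invariant set of at least three points has only monomial stabilising
matrices and `|W|` is large enough. An orbit `{± t, ± 1/t}` works when its cross ratio is neither
harmonic nor equianharmonic: `t = 2` serves for most primes, `t = 4` for 37 and 41, and a six-point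
set for 17.

Conversely, a digraph with group `G(m,p)` is a Cayley digraph. Its connection set is constant on
linearly independent pairs, so apart from `0` it amounts to one bit there and a 2-colouring of the
`D₈`-orbits on the projective line. For `p = 5, 7, 13` each colouring is preserved by a non-monomial
`M`, and `M ⊗ 1` is an extra automorphism. For `p = 3` there are only two orbits, and the bit for
independent pairs has to be used as well. -/

/-! ### Coordinates: the group as monomial affine maps of `W × W` -/

section Coordinates

variable {F V W : Type*} [Field F] [AddCommGroup V] [Module F V] [AddCommGroup W] [Module F W]

/-- The coordinates of `V ⊗ W` given by a basis of the plane `V`. -/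
noncomputable def tensorCoord (e : Module.Basis (Fin 2) F V) : (V ⊗[F] W) ≃ₗ[F] W × W :=
  (TensorProduct.equivFinsuppOfBasisLeft e).trans
    ((Finsupp.linearEquivFunOnFinite F W (Fin 2)).trans (LinearEquiv.finTwoArrow F W))

theorem tensorCoord_tmul (e : Module.Basis (Fin 2) F V) (v : V) (w : W) :
    tensorCoord e (v ⊗ₜ[F] w) = (e.repr v 0 • w, e.repr v 1 • w) := by
  simp [tensorCoord]

theorem tensorCoord_symm_apply (e : Module.Basis (Fin 2) F V) (x y : W) :
    (tensorCoord e).symm (x, y) = e 0 ⊗ₜ[F] x + e 1 ⊗ₜ[F] y := by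
  rw [LinearEquiv.symm_apply_eq, map_add, tensorCoord_tmul, tensorCoord_tmul]
  simp

/-- The maps `(x, y) ↦ (g x, ± g y) + c` and `(x, y) ↦ (g y, ± g x) + c`. -/
def IsMonomialAffine (F : Type*) {W : Type*} [Field F] [AddCommGroup W] [Module F W]
    (τ : W × W → W × W) : Prop :=
  ∃ (g : W ≃ₗ[F] W) (ε : F) (c : W × W), (ε = 1 ∨ ε = -1) ∧
    ((∀ x y, τ (x, y) = (g x, ε • g y) + c) ∨ ∀ x y, τ (x, y) = (g y, ε • g x) + c)

/-- The linear maps that permute the basis `e` up to signs. -/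
def IsSignedPerm (e : Module.Basis (Fin 2) F V) (a : V ≃ₗ[F] V) : Prop :=
  ∃ ε δ : F, (ε = 1 ∨ ε = -1) ∧ (δ = 1 ∨ δ = -1) ∧
    ((a (e 0) = ε • e 0 ∧ a (e 1) = δ • e 1) ∨ (a (e 0) = ε • e 1 ∧ a (e 1) = δ • e 0))

theorem toMatrix_basis_eq_iff (e : Module.Basis (Fin 2) F V) (a : V ≃ₗ[F] V) (p q r s : F) :
    LinearMap.toMatrix e e (a : V →ₗ[F] V) = !![p, q; r, s] ↔
      a (e 0) = p • e 0 + r • e 1 ∧ a (e 1) = q • e 0 + s • e 1 := by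
  constructor
  · intro h
    have h1 (j : Fin 2) : a (e j) = ∑ i, LinearMap.toMatrix e e (a : V →ₗ[F] V) i j • e i := by
      simp [LinearMap.toMatrix_apply, e.sum_repr]
    rw [h1, h1, h]
    simp [Fin.sum_univ_two]
  · rintro ⟨h0, h1⟩
    ext i j
    fin_cases i <;> fin_cases j <;> simp [LinearMap.toMatrix_apply, h0, h1]

theorem isSignedPerm_of_mem_dihedralD8 (e : Module.Basis (Fin 2) F V) {a : V ≃ₗ[F] V}
    (ha : a ∈ dihedralD8 e) : IsSignedPerm e a := by
  have sq (ε : F) (h : ε = 1 ∨ ε = -1) : ε * ε = 1 := by rcases h with rfl | rfl <;> simp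
  have mulc (ε δ : F) (h : ε = 1 ∨ ε = -1) (h' : δ = 1 ∨ δ = -1) :
      ε * δ = 1 ∨ ε * δ = -1 := by
    rcases h with rfl | rfl <;> rcases h' with rfl | rfl <;> simp
  induction ha using Subgroup.closure_induction with
  | mem a h =>
    rcases h with h | h <;> rw [toMatrix_basis_eq_iff] at h
    · exact ⟨1, -1, by simp, by simp, Or.inl (by simpa using h)⟩
    · exact ⟨1, 1, by simp, by simp, Or.inr (by simpa using h)⟩
  | one => exact ⟨1, 1, by simp, by simp, Or.inl (by simp)⟩
  | mul a b _ _ ha hb =>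
    obtain ⟨ε, δ, hε, hδ, ha⟩ := ha
    obtain ⟨ε', δ', hε', hδ', hb⟩ := hb
    rcases ha with ⟨h1, h2⟩ | ⟨h1, h2⟩ <;> rcases hb with ⟨h3, h4⟩ | ⟨h3, h4⟩
    · exact ⟨ε' * ε, δ' * δ, mulc _ _ hε' hε, mulc _ _ hδ' hδ,
        Or.inl (by simp [h1, h2, h3, h4, mul_smul])⟩
    · exact ⟨ε' * δ, δ' * ε, mulc _ _ hε' hδ, mulc _ _ hδ' hε,
        Or.inr (by simp [h1, h2, h3, h4, mul_smul])⟩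
    · exact ⟨ε' * ε, δ' * δ, mulc _ _ hε' hε, mulc _ _ hδ' hδ,
        Or.inr (by simp [h1, h2, h3, h4, mul_smul])⟩
    · exact ⟨ε' * δ, δ' * ε, mulc _ _ hε' hδ, mulc _ _ hδ' hε,
        Or.inl (by simp [h1, h2, h3, h4, mul_smul])⟩
  | inv a _ ha =>
    obtain ⟨ε, δ, hε, hδ, ha⟩ := ha
    have hinv (v w : V) (η : F) (hη : η = 1 ∨ η = -1) (h : a v = η • w) : a⁻¹ w = η • v := by
      have : a⁻¹ (a v) = v := by rw [← LinearEquiv.mul_apply, inv_mul_cancel]; rfl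
      rw [h, map_smul] at this
      rw [← this, smul_smul, sq η hη, one_smul]
    rcases ha with ⟨h1, h2⟩ | ⟨h1, h2⟩
    · exact ⟨ε, δ, hε, hδ, Or.inl ⟨hinv _ _ _ hε h1, hinv _ _ _ hδ h2⟩⟩
    · exact ⟨δ, ε, hδ, hε, Or.inr ⟨hinv _ _ _ hδ h2, hinv _ _ _ hε h1⟩⟩

theorem exists_mem_dihedralD8_diag (e : Module.Basis (Fin 2) F V) {ε : F} (hε : ε = 1 ∨ ε = -1) :
    ∃ a ∈ dihedralD8 e, a (e 0) = e 0 ∧ a (e 1) = ε • e 1 := by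
  rcases hε with rfl | rfl
  · exact ⟨1, one_mem _, by simp⟩
  · have hu : ∀ i : Fin 2, IsUnit ((![1, -1] : Fin 2 → F) i) := by
      intro i; fin_cases i <;> simp
    let a : V ≃ₗ[F] V := e.equiv (e.isUnitSMul hu) (Equiv.refl _)
    have h0 : a (e 0) = e 0 := by simp [a, Module.Basis.isUnitSMul_apply]
    have h1 : a (e 1) = (-1 : F) • e 1 := by simp [a, Module.Basis.isUnitSMul_apply]
    refine ⟨a, Subgroup.subset_closure (Or.inl ?_), h0, h1⟩
    rw [toMatrix_basis_eq_iff]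
    simp [h0, h1]

theorem exists_mem_dihedralD8_swap (e : Module.Basis (Fin 2) F V) :
    ∃ a ∈ dihedralD8 e, a (e 0) = e 1 ∧ a (e 1) = e 0 := by
  let a : V ≃ₗ[F] V := e.equiv e (Equiv.swap 0 1)
  have h0 : a (e 0) = e 1 := by simp [a]
  have h1 : a (e 1) = e 0 := by simp [a]
  refine ⟨a, Subgroup.subset_closure (Or.inr ?_), h0, h1⟩
  rw [toMatrix_basis_eq_iff]
  simp [h0, h1]

theorem mem_affineGroupG_iff (e : Module.Basis (Fin 2) F V) (σ : Equiv.Perm (V ⊗[F] W)) :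
    σ ∈ affineGroupG e W ↔
      IsMonomialAffine F fun z => tensorCoord e (σ ((tensorCoord e).symm z)) := by
  constructor
  · rintro ⟨θ, ⟨a, ha, g, rfl⟩, c, hσ⟩
    obtain ⟨ε, δ, hε, hδ, h⟩ := isSignedPerm_of_mem_dihedralD8 e ha
    have hεδ : ε * δ = 1 ∨ ε * δ = -1 := by
      rcases hε with rfl | rfl <;> rcases hδ with rfl | rfl <;> simp
    have hε2 : ε * ε = 1 := by rcases hε with rfl | rfl <;> simp
    have hδ2 : δ * δ = 1 := by rcases hδ with rfl | rfl <;> simp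
    have hε0 : ε ≠ 0 := by rintro rfl; simp at hε2
    have hδ0 : δ ≠ 0 := by rintro rfl; simp at hδ2
    rcases h with ⟨h0, h1⟩ | ⟨h0, h1⟩
    -- `diag(ε, δ) = ε · diag(1, εδ)`, and the scalar `ε` is absorbed into `g`.
    · refine ⟨g.trans (LinearEquiv.smulOfNeZero F W ε hε0), ε * δ, tensorCoord e c, hεδ,
        Or.inl fun x y => ?_⟩
      simp only [hσ, tensorCoord_symm_apply, map_add, TensorProduct.congr_tmul, h0, h1,
        tensorCoord_tmul]
      ext <;> simp [smul_smul, mul_right_comm, hε2]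
    · refine ⟨g.trans (LinearEquiv.smulOfNeZero F W δ hδ0), ε * δ, tensorCoord e c, hεδ,
        Or.inr fun x y => ?_⟩
      simp only [hσ, tensorCoord_symm_apply, map_add, TensorProduct.congr_tmul, h0, h1,
        tensorCoord_tmul]
      ext <;> simp [smul_smul, mul_assoc, hδ2]
  · rintro ⟨g, ε, c, hε, h⟩
    obtain ⟨a, ha, ha0, ha1⟩ := exists_mem_dihedralD8_diag e hε
    have key (b : V ≃ₗ[F] V) (hb : b ∈ dihedralD8 e)
        (h : ∀ x y, tensorCoord e (σ ((tensorCoord e).symm (x, y))) =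
          tensorCoord e (TensorProduct.congr b g ((tensorCoord e).symm (x, y))) + c) :
        σ ∈ affineGroupG e W := by
      refine ⟨_, ⟨b, hb, g, rfl⟩, (tensorCoord e).symm c, fun z => ?_⟩
      obtain ⟨⟨x, y⟩, rfl⟩ := (tensorCoord e).symm.surjective z
      apply (tensorCoord e).injective
      rw [h, map_add, LinearEquiv.apply_symm_apply]
    simp only at h
    rcases h with h | h
    · refine key a ha fun x y => ?_
      rw [h]
      simp [tensorCoord_symm_apply, ha0, ha1, tensorCoord_tmul]
    · obtain ⟨b, hb, hb0, hb1⟩ := exists_mem_dihedralD8_swap e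
      refine key (a * b) (mul_mem ha hb) fun x y => ?_
      rw [h]
      simp [tensorCoord_symm_apply, ha0, ha1, hb0, hb1, tensorCoord_tmul]

end Coordinates

/-! ### Collineations of translation nets -/

section Net

/-- If `x, y, z` are pairwise collinear in a translation net but not on a common line, then they
have few common neighbours. -/
theorem ncard_common_le {ι A : Type*} [Fintype ι] [AddCommGroup A] [Finite A]
    (U : ι → AddSubgroup A) (hU : ∀ i j, i ≠ j → U i ⊓ U j = ⊥) {i : ι} {x y z : A}
    (hxy : x ≠ y) (hi : x - y ∈ U i) (hz : z - x ∉ U i) :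
    {u | (∃ a, u - x ∈ U a) ∧ (∃ b, u - y ∈ U b) ∧ ∃ c, u - z ∈ U c}.ncard ≤
      Fintype.card ι ^ 2 + Fintype.card ι := by
  classical
  have uniq {a b : ι} (hab : a ≠ b) {p q u v : A} (h1 : u - p ∈ U a) (h2 : u - q ∈ U b)
      (h3 : v - p ∈ U a) (h4 : v - q ∈ U b) : u = v := by
    have h : u - v ∈ U a ⊓ U b :=
      ⟨by simpa using sub_mem h1 h3, by simpa using sub_mem h2 h4⟩
    rw [hU a b hab] at h
    exact sub_eq_zero.1 h
  have : Nonempty ι := ⟨i⟩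
  choose! f hf using fun u : A => fun h : ∃ a, u - x ∈ U a => h
  choose! g hg using fun u : A => fun h : ∃ a, u - y ∈ U a => h
  choose! k hk using fun u : A => fun h : ∃ a, u - z ∈ U a => h
  -- If the lines from `u` to `x` and to `y` have different classes, those classes determine `u`. If
  -- they agree, `u` lies on the line `xy`, and the class of its line to `z`, which meets `xy` at
  -- most once, determines `u`.
  let φ : A → (ι × ι) ⊕ ι := fun u => if f u = g u then Sum.inr (k u) else Sum.inl (f u, g u)
  have eqi {u : A} (h1 : ∃ a, u - x ∈ U a) (h2 : ∃ a, u - y ∈ U a) (h : f u = g u) : f u = i := by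
    by_contra hne
    have h3 : x - y ∈ U (f u) := by
      have := sub_mem (hg u h2) (h ▸ hf u h1)
      rw [h]
      simpa using this
    have h4 : x - y ∈ U (f u) ⊓ U i := ⟨h3, hi⟩
    rw [hU _ _ hne] at h4
    exact hxy (sub_eq_zero.1 h4)
  have hinj : Set.InjOn φ {u | (∃ a, u - x ∈ U a) ∧ (∃ b, u - y ∈ U b) ∧ ∃ c, u - z ∈ U c} := by
    rintro u ⟨u1, u2, u3⟩ v ⟨v1, v2, v3⟩ huv
    simp only [φ] at huv
    split_ifs at huv with h h' h'
    · have hu := hf u u1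
      have hv := hf v v1
      rw [eqi u1 u2 h] at hu
      rw [eqi v1 v2 h'] at hv
      have huk := hk u u3
      have hvk := hk v v3
      rw [← Sum.inr.inj huv] at hvk
      refine uniq (fun hik => hz ?_) hu huk hv hvk
      rw [← hik] at huk
      simpa using sub_mem hu huk
    · simp only [Sum.inl.injEq, Prod.mk.injEq] at huv
      have h1 := hf v v1
      have h2 := hg v v2
      rw [← huv.1] at h1
      rw [← huv.2] at h2
      exact uniq h (hf u u1) (hg u u2) h1 h2
  calc _ ≤ (Set.univ : Set ((ι × ι) ⊕ ι)).ncard :=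
        Set.ncard_le_ncard_of_injOn φ (fun _ _ => Set.mem_univ _) hinj
    _ = _ := by simp [Set.ncard_univ, Nat.card_eq_fintype_card, sq]

variable {ι A : Type*} [Fintype ι] [AddCommGroup A] [Finite A]
  (U : ι → AddSubgroup A)

/-- A bijection that preserves collinearity in a translation net with lines of size large compared
to the number of parallel classes maps lines into lines. -/
theorem map_line_of_preserves_collinear (hU : ∀ i j, i ≠ j → U i ⊓ U j = ⊥)
    (hcard : ∀ i, Fintype.card ι ^ 2 + Fintype.card ι < Nat.card (U i)) (σ : Equiv.Perm A)
    (hσ : ∀ x y, (∃ i, σ x - σ y ∈ U i) ↔ ∃ i, x - y ∈ U i) {i j : ι} {x y z : A}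
    (hxy : x ≠ y) (hi : x - y ∈ U i) (hj : σ x - σ y ∈ U j) (hz : z - x ∈ U i) :
    σ z - σ x ∈ U j := by
  by_contra hne
  -- Every point of the original line is sent to a common neighbour of `σ x`, `σ y`, `σ z`; if these
  -- were not on a line, there would be too many.
  have h := ncard_common_le U hU (σ.injective.ne hxy) hj hne
  refine (h.trans_lt (hcard i)).not_ge ?_
  rw [← SetLike.coe_sort_coe, Nat.card_coe_set_eq]
  refine Set.ncard_le_ncard_of_injOn (fun u => σ (u + x)) (fun u hu => ?_) ?_
  · refine ⟨(hσ _ _).2 ⟨i, by simpa using hu⟩, (hσ _ _).2 ⟨i, ?_⟩, (hσ _ _).2 ⟨i, ?_⟩⟩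
    · rw [add_sub_assoc]
      exact add_mem hu hi
    · rw [add_sub_assoc, ← neg_sub z x]
      exact add_mem hu (neg_mem hz)
  · intro u _ v _ huv
    simpa using huv

/-- A bijection that preserves collinearity in a translation net permutes the parallel classes. -/
theorem exists_map_parallel_class (hU : ∀ i j, i ≠ j → U i ⊓ U j = ⊥)
    (hsup : ∀ i j, i ≠ j → U i ⊔ U j = ⊤)
    (hcard : ∀ i, Fintype.card ι ^ 2 + Fintype.card ι < Nat.card (U i)) (σ : Equiv.Perm A)
    (hσ : ∀ x y, (∃ i, σ x - σ y ∈ U i) ↔ ∃ i, x - y ∈ U i) :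
    ∃ π : ι → ι, Function.Injective π ∧ ∀ i x y, x - y ∈ U i → σ x - σ y ∈ U (π i) := by
  have hσ' : ∀ x y, (∃ i, σ.symm x - σ.symm y ∈ U i) ↔ ∃ i, x - y ∈ U i := fun x y => by
    rw [← hσ]; simp
  have hne (i : ι) : ∃ v ∈ U i, v ≠ 0 := by
    have : 1 < Nat.card (U i) := lt_of_le_of_lt (by
      have := Fintype.card_pos_iff.2 ⟨i⟩
      omega) (hcard i)
    have := (AddSubgroup.one_lt_card_iff_ne_bot _).1 this
    obtain ⟨w, hw⟩ := (AddSubgroup.ne_bot_iff_exists_ne_zero (H := U i)).1 this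
    exact ⟨w, w.2, by simpa using hw⟩
  choose v hv hv0 using hne
  have hJ (i : ι) (x : A) : ∃ j, ∀ z, z - x ∈ U i → σ z - σ x ∈ U j := by
    obtain ⟨j, hj⟩ := (hσ x (x + v i)).2 ⟨i, by simpa using hv i⟩
    exact ⟨j, fun z hz => map_line_of_preserves_collinear U hU hcard σ hσ
      (by simpa using hv0 i) (by simpa using hv i) hj hz⟩
  have hJ' (i j : ι) (x : A) (h : ∀ z, z - x ∈ U i → σ z - σ x ∈ U j) (w : A)
      (hw : w - σ x ∈ U j) : σ.symm w - x ∈ U i := by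
    have h1 := h (x + v i) (by simpa using hv i)
    have := map_line_of_preserves_collinear U hU hcard σ.symm hσ' (i := j) (j := i)
      (x := σ x) (y := σ (x + v i)) (z := w)
      (by simpa using hv0 i) (by rw [← neg_sub]; exact neg_mem h1) (by simpa using hv i) hw
    simpa using this
  choose J hJ using hJ
  -- If parallel lines had images in different classes, the images would meet because the two
  -- subgroups span `A`. The lines would then coincide, and their common image would lie in two
  -- classes at once.
  have const (i : ι) (x y : A) : J i x = J i y := by
    by_contra hxy
    have hmem : σ y - σ x ∈ U (J i x) ⊔ U (J i y) := by
      rw [hsup _ _ hxy]; trivial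
    obtain ⟨p, hp, q, hq, hpq⟩ := AddSubgroup.mem_sup.1 hmem
    have h1 := hJ' i _ x (hJ i x) (σ x + p) (by simpa using hp)
    have h2 := hJ' i _ y (hJ i y) (σ x + p) (by
      have : σ x + p - σ y = -q := by rw [← sub_eq_zero, ← sub_eq_zero.2 hpq]; abel
      rw [this]; exact neg_mem hq)
    have hyx : y - x ∈ U i := by simpa using sub_mem h1 h2
    have h3 : σ (x + v i) - σ x ∈ U (J i x) := hJ i x _ (by simpa using hv i)
    have h4 : σ (x + v i) - σ x ∈ U (J i y) := by
      have a1 := hJ i y (x + v i) (by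
        have : x + v i - y = v i - (y - x) := by abel
        rw [this]; exact sub_mem (hv i) hyx)
      have a2 := hJ i y x (by rw [← neg_sub]; exact neg_mem hyx)
      simpa using sub_mem a1 a2
    have h5 : σ (x + v i) - σ x ∈ U (J i x) ⊓ U (J i y) := ⟨h3, h4⟩
    rw [hU _ _ hxy] at h5
    have h6 := σ.injective (sub_eq_zero.1 h5)
    exact hv0 i (by simpa using h6)
  refine ⟨fun i => J i 0, fun i j hij => ?_, fun i x y hxy => ?_⟩
  · by_contra hne
    simp only at hij
    have h1 := hJ' j _ 0 (hJ j 0) (σ (v i)) (by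
      rw [← hij]; exact hJ i 0 _ (by simpa using hv i))
    have h2 : v i ∈ U i ⊓ U j := ⟨hv i, by simpa using h1⟩
    rw [hU _ _ hne] at h2
    exact hv0 i h2
  · change _ ∈ U (J i 0)
    rw [const i 0 y]
    exact hJ i y x hxy

end Net

/-! ### The parallel classes `v ⊗ W` -/

section NetClass

variable {F W : Type*} [Field F] [AddCommGroup W] [Module F W]

/-- The subgroup `v ⊗ W` of `W × W`, for a vector `v` of the plane `F × F`. -/
def netClass (W : Type*) [AddCommGroup W] [Module F W] (v : F × F) : AddSubgroup (W × W) where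
  carrier := {z | v.2 • z.1 = v.1 • z.2}
  zero_mem' := by simp
  add_mem' {z z'} h h' := by
    simp only [Set.mem_ofPred_eq, Prod.fst_add, Prod.snd_add, smul_add] at h h' ⊢
    rw [h, h']
  neg_mem' {z} h := by
    simp only [Set.mem_ofPred_eq, Prod.fst_neg, Prod.snd_neg, smul_neg] at h ⊢
    rw [h]

theorem mem_netClass {v : F × F} {z : W × W} : z ∈ netClass W v ↔ v.2 • z.1 = v.1 • z.2 :=
  Iff.rfl

/-- The determinant of two plane vectors. -/
def planeDet (u v : F × F) : F := u.1 * v.2 - u.2 * v.1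

theorem netClass_inf_eq_bot {u v : F × F} (h : planeDet u v ≠ 0) :
    netClass W u ⊓ netClass W v = ⊥ := by
  rw [eq_bot_iff]
  rintro ⟨x, y⟩ ⟨h1, h2⟩
  replace h1 : u.2 • x = u.1 • y := h1
  replace h2 : v.2 • x = v.1 • y := h2
  have hx : planeDet u v • x = 0 := by
    unfold planeDet
    linear_combination (norm := module) u.1 • h2 - v.1 • h1
  have hy : planeDet u v • y = 0 := by
    unfold planeDet
    linear_combination (norm := module) u.2 • h2 - v.2 • h1
  rw [smul_eq_zero_iff_right h] at hx hy
  simp [hx, hy]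

theorem netClass_sup_eq_top {u v : F × F} (h : planeDet u v ≠ 0) :
    netClass W u ⊔ netClass W v = ⊤ := by
  rw [eq_top_iff]
  rintro ⟨x, y⟩ -
  let w := (planeDet u v)⁻¹ • (v.2 • x - v.1 • y)
  let w' := (planeDet u v)⁻¹ • (u.1 • y - u.2 • x)
  refine AddSubgroup.mem_sup.2 ⟨(u.1 • w, u.2 • w), ?_, (v.1 • w', v.2 • w'), ?_, ?_⟩
  · simp [mem_netClass, smul_smul, mul_comm]
  · simp [mem_netClass, smul_smul, mul_comm]
  · have hd : (planeDet u v)⁻¹ * (u.1 * v.2 - u.2 * v.1) = 1 := inv_mul_cancel₀ h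
    ext
    · simp only [w, w', Prod.fst_add]
      linear_combination (norm := module) hd • x
    · simp only [w, w', Prod.snd_add]
      linear_combination (norm := module) hd • y

theorem card_le_card_netClass [Finite W] {v : F × F} (hv : v ≠ 0) :
    Nat.card W ≤ Nat.card (netClass W v) := by
  refine Nat.card_le_card_of_injective
    (fun w : W => (⟨(v.1 • w, v.2 • w), by simp [mem_netClass, smul_smul, mul_comm]⟩ :
      netClass W v)) fun w w' h => ?_
  simp only [Subtype.mk.injEq, Prod.mk.injEq] at h
  by_cases h1 : v.1 = 0
  · have h2 : v.2 ≠ 0 := fun h2 => hv (Prod.ext h1 h2)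
    exact smul_right_injective W h2 h.2
  · exact smul_right_injective W h1 h.1

theorem ne_zero_of_planeDet_ne_zero {u v : F × F} (h : planeDet u v ≠ 0) : u ≠ 0 := by
  rintro rfl
  simp [planeDet] at h

/-- The net lemma for the parallel classes given by pairwise independent plane vectors. -/
theorem exists_map_netClass [Finite W] {ι : Type*} [Fintype ι] [Nontrivial ι] (v : ι → F × F)
    (hv : ∀ i j, i ≠ j → planeDet (v i) (v j) ≠ 0)
    (hcard : Fintype.card ι ^ 2 + Fintype.card ι < Nat.card W) (σ : Equiv.Perm (W × W))
    (hσ : ∀ x y, (∃ i, σ x - σ y ∈ netClass W (v i)) ↔ ∃ i, x - y ∈ netClass W (v i)) :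
    ∃ π : ι → ι, Function.Injective π ∧
      ∀ i x y, x - y ∈ netClass W (v i) → σ x - σ y ∈ netClass W (v (π i)) := by
  refine exists_map_parallel_class (fun i => netClass W (v i))
    (fun i j h => netClass_inf_eq_bot (hv i j h)) (fun i j h => netClass_sup_eq_top (hv i j h))
    (fun i => hcard.trans_le (card_le_card_netClass ?_)) σ hσ
  obtain ⟨j, hj⟩ := exists_ne i
  exact ne_zero_of_planeDet_ne_zero (hv i j hj.symm)

end NetClass

/-! ### Three parallel classes force affinity -/

section Affine

variable {p : ℕ} [Fact p.Prime] {W : Type*} [AddCommGroup W] [Module (ZMod p) W]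

/-- A permutation of `W × W` that permutes at least three parallel classes is affine, of the form
`M ⊗ f`. -/
theorem exists_matrix_of_map_netClass {ι : Type*} (v : ι → ZMod p × ZMod p)
    (hv : ∀ i j, i ≠ j → planeDet (v i) (v j) ≠ 0) (σ : Equiv.Perm (W × W)) {π : ι → ι}
    (hπ : Function.Injective π)
    (hσ : ∀ i x y, x - y ∈ netClass W (v i) → σ x - σ y ∈ netClass W (v (π i)))
    {i j k : ι} (hij : i ≠ j) (hjk : j ≠ k) (hki : k ≠ i) :
    ∃ (f : W →ₗ[ZMod p] W) (a b c d : ZMod p),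
      ∀ x y, σ (x, y) = (a • f x + b • f y, c • f x + d • f y) + σ 0 := by
  -- The level sets of `l i` are the lines of class `i`, so `P i z` depends only on `l i z`. Any
  -- three of the `l` are linearly dependent, by `hrel`.
  let l : ι → W × W → W := fun i z => (v i).2 • z.1 - (v i).1 • z.2
  let P : ι → W × W → W := fun i z => l (π i) (σ z - σ 0)
  have hP (i : ι) (z z' : W × W) (h : l i z = l i z') : P i z = P i z' := by
    have h1 : z - z' ∈ netClass W (v i) := by
      rw [mem_netClass]
      simp only [l] at h
      simp only [Prod.fst_sub, Prod.snd_sub]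
      linear_combination (norm := module) h
    have h2 := hσ i z z' h1
    rw [mem_netClass] at h2
    simp only [Prod.fst_sub, Prod.snd_sub] at h2
    simp only [P, l, Prod.fst_sub, Prod.snd_sub]
    linear_combination (norm := module) h2
  have hP0 (i : ι) : P i 0 = 0 := by simp [P, l]
  have hrel (a b c : ι) (z : W × W) : planeDet (v b) (v c) • l a z + planeDet (v c) (v a) • l b z
      + planeDet (v a) (v b) • l c z = 0 := by
    simp only [l, planeDet]
    module
  have hD := hv i j hij
  have hD1 := hv j k hjk
  have hD2 := hv k i hki
  have hE := hv _ _ (hπ.ne hij)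
  have hE1 := hv _ _ (hπ.ne hjk)
  have hE2 := hv _ _ (hπ.ne hki)
  let Z : W → W → W × W := fun X Y => (planeDet (v i) (v j))⁻¹ •
    ((v i).1 • Y - (v j).1 • X, (v i).2 • Y - (v j).2 • X)
  have hinv : (planeDet (v i) (v j))⁻¹ * ((v i).1 * (v j).2 - (v i).2 * (v j).1) = 1 :=
    inv_mul_cancel₀ hD
  have hZ1 (X Y : W) : l i (Z X Y) = X := by
    simp only [l, Z, Prod.smul_fst, Prod.smul_snd]
    linear_combination (norm := module) hinv • X
  have hZ2 (X Y : W) : l j (Z X Y) = Y := by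
    simp only [l, Z, Prod.smul_fst, Prod.smul_snd]
    linear_combination (norm := module) hinv • Y
  have hl0 (i : ι) : l i 0 = 0 := by simp [l]
  have hZ3 (X Y : W) : planeDet (v i) (v j) • l k (Z X Y) =
      - (planeDet (v j) (v k) • X + planeDet (v k) (v i) • Y) := by
    have := hrel i j k (Z X Y)
    rw [hZ1, hZ2] at this
    linear_combination (norm := module) this
  -- `Z X Y` is the point with `l i = X` and `l j = Y`. There `l k` depends only on `X + r • Y`, so
  -- `A X + B Y` is a function of `X + r • Y`: a Cauchy equation, which makes `A` additive.
  let r := (planeDet (v j) (v k))⁻¹ * planeDet (v k) (v i)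
  have hr : planeDet (v j) (v k) * r = planeDet (v k) (v i) := by
    simp only [r]; field_simp
  have hr0 : r ≠ 0 := mul_ne_zero (inv_ne_zero hD1) hD2
  have hk (X Y : W) : P k (Z X Y) = P k (Z (X + r • Y) 0) := by
    refine hP _ _ _ (smul_right_injective W hD ?_)
    simp only [hZ3, smul_zero, add_zero, smul_add, smul_smul, hr]
  let A : W → W := fun X => planeDet (v (π j)) (v (π k)) • P i (Z X 0)
  let B : W → W := fun Y => planeDet (v (π k)) (v (π i)) • P j (Z 0 Y)
  have hA0 : A 0 = 0 := by
    simp only [A]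
    rw [hP i (Z 0 0) 0 (by rw [hZ1, hl0]), hP0, smul_zero]
  have hB0 : B 0 = 0 := by
    simp only [B]
    rw [hP j (Z 0 0) 0 (by rw [hZ2, hl0]), hP0, smul_zero]
  have hAB (X Y : W) : A X + B Y = -(planeDet (v (π i)) (v (π j)) • P k (Z X Y)) := by
    have := hrel (π i) (π j) (π k) (σ (Z X Y) - σ 0)
    simp only [A, B]
    rw [hP i (Z X 0) (Z X Y) (by rw [hZ1, hZ1]), hP j (Z 0 Y) (Z X Y) (by rw [hZ2, hZ2])]
    exact eq_neg_of_add_eq_zero_left this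
  have hadd1 (X Y : W) : A X + B Y = A (X + r • Y) := by
    rw [hAB, hk, ← hAB, hB0, add_zero]
  have hB (Y : W) : B Y = A (r • Y) := by simpa [hA0] using hadd1 0 Y
  have hadd (X Y : W) : A (X + Y) = A X + A Y := by
    have := hadd1 X (r⁻¹ • Y)
    rw [hB, smul_inv_smul₀ hr0] at this
    exact this.symm
  -- Additive maps are linear because the field is prime.
  let f : W →ₗ[ZMod p] W := AddMonoidHom.toZModLinearMap p ⟨⟨A, hA0⟩, hadd⟩
  have hf (X : W) : f X = A X := rfl
  have hPi (z : W × W) : planeDet (v (π j)) (v (π k)) • P i z = f (l i z) := by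
    rw [hf]
    simp only [A]
    rw [hP i z _ (hZ1 (l i z) 0).symm]
  have hPj (z : W × W) : planeDet (v (π k)) (v (π i)) • P j z = r • f (l j z) := by
    rw [← map_smul, hf, ← hB]
    simp only [B]
    rw [hP j z _ (hZ2 0 (l j z)).symm]
  have hPi' (z : W × W) : P i z = (planeDet (v (π j)) (v (π k)))⁻¹ • f (l i z) := by
    rw [← hPi, inv_smul_smul₀ hE1]
  have hPj' (z : W × W) : P j z = (planeDet (v (π k)) (v (π i)))⁻¹ • r • f (l j z) := by
    rw [← hPj, inv_smul_smul₀ hE2]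
  have hinv' : (planeDet (v (π i)) (v (π j)))⁻¹ *
      ((v (π i)).1 * (v (π j)).2 - (v (π i)).2 * (v (π j)).1) = 1 := inv_mul_cancel₀ hE
  have hfst (z : W × W) : (σ z - σ 0).1 = (planeDet (v (π i)) (v (π j)))⁻¹ •
      ((v (π i)).1 • P j z - (v (π j)).1 • P i z) := by
    simp only [P, l]
    linear_combination (norm := module) - hinv' • (σ z - σ 0).1
  have hsnd (z : W × W) : (σ z - σ 0).2 = (planeDet (v (π i)) (v (π j)))⁻¹ •
      ((v (π i)).2 • P j z - (v (π j)).2 • P i z) := by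
    simp only [P, l]
    linear_combination (norm := module) - hinv' • (σ z - σ 0).2
  have hl (i : ι) (x y : W) : f (l i (x, y)) = (v i).2 • f x - (v i).1 • f y := by
    simp only [l, map_sub, map_smul]
  generalize (planeDet (v (π i)) (v (π j)))⁻¹ = E at hfst hsnd
  generalize (planeDet (v (π j)) (v (π k)))⁻¹ = E1 at hPi'
  generalize (planeDet (v (π k)) (v (π i)))⁻¹ = E2 at hPj'
  refine ⟨f, E * ((v (π i)).1 * (E2 * r * (v j).2) - (v (π j)).1 * (E1 * (v i).2)),
    - E * ((v (π i)).1 * (E2 * r * (v j).1) - (v (π j)).1 * (E1 * (v i).1)),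
    E * ((v (π i)).2 * (E2 * r * (v j).2) - (v (π j)).2 * (E1 * (v i).2)),
    - E * ((v (π i)).2 * (E2 * r * (v j).1) - (v (π j)).2 * (E1 * (v i).1)), fun x y => ?_⟩
  rw [← sub_eq_iff_eq_add]
  ext
  · rw [hfst, hPi', hPj', hl, hl]
    module
  · rw [hsnd, hPi', hPj', hl, hl]
    module

end Affine

/-! ### Maps additive up to sign -/

section SignedAdditive

variable {W : Type*} [AddCommGroup W]

/-- Exchanging `x` and `z` gives a second sign. If both signs are minus then `f x = f z`, so `x = z`
and `f (x + x) = 0`, which forces `x = 0`. -/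
theorem map_add_of_map_sub_eq_or (h2 : ∀ w : W, w + w = 0 → w = 0) {f : W → W}
    (hf0 : f 0 = 0) (hf : Function.Injective f)
    (h : ∀ x z, f (x + z) = f x + f z ∨ f (x + z) = f x - f z) (x z : W) :
    f (x + z) = f x + f z := by
  rcases h x z with h1 | h1
  · exact h1
  rcases h z x with h3 | h3
  · rw [add_comm x z, h3, add_comm]
  · rw [add_comm z x, h1] at h3
    have h4 : f x = f z := by
      rw [← sub_eq_zero]
      apply h2
      rw [sub_eq_sub_iff_add_eq_add] at h3
      rw [← sub_eq_zero] at h3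
      rw [← h3]
      abel
    obtain rfl := hf h4
    have h5 : x + x = 0 := hf (by rw [h1, hf0, sub_self])
    obtain rfl := h2 _ h5
    simp [hf0]

/-- The sets `h = f` and `h = -f` are subgroups covering `W`, and a group is not the union of two
proper subgroups. -/
theorem eq_or_eq_neg_of_pointwise (h2 : ∀ w : W, w + w = 0 → w = 0) {f h : W → W}
    (hf : ∀ x z, f (x + z) = f x + f z) (hh : ∀ x z, h (x + z) = h x + h z)
    (H : ∀ x, h x = f x ∨ h x = -f x) : (∀ x, h x = f x) ∨ ∀ x, h x = -f x := by
  by_contra! hne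
  obtain ⟨⟨a, ha⟩, b, hb⟩ := hne
  have ha' := (H a).resolve_left ha
  have hb' := (H b).resolve_right hb
  rcases H (a + b) with h1 | h1 <;> rw [hf, hh, ha', hb'] at h1
  · have : f a = 0 := h2 _ (by
      have := add_right_cancel h1
      rw [neg_eq_iff_add_eq_zero] at this
      exact this)
    simp [this] at ha' ha
    exact ha ha'
  · have : f b = 0 := h2 _ (by
      rw [neg_add] at h1
      have := add_left_cancel h1
      rw [eq_neg_iff_add_eq_zero] at this
      exact this)
    simp [this] at hb' hb
    exact hb hb'

end SignedAdditive

/-! ### 2-closedness -/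

section TwoClosed

variable {p : ℕ} [Fact p.Prime] {W : Type*} [AddCommGroup W] [Module (ZMod p) W]

theorem eq_zero_of_add_self_eq_zero (hp : Odd p) (w : W) (h : w + w = 0) : w = 0 := by
  have h2 : (2 : ZMod p) ≠ 0 := by
    have : ((2 : ℕ) : ZMod p) ≠ 0 := by
      rw [Ne, ZMod.natCast_eq_zero_iff]
      intro h
      have := (Nat.prime_dvd_prime_iff_eq Fact.out Nat.prime_two).1 h
      subst this
      exact absurd hp (by decide)
    exact_mod_cast this
  rw [← two_smul (ZMod p)] at h
  exact (smul_eq_zero_iff_right h2).1 h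

/-- A permutation acting separately on the two coordinates and preserving the union of the diagonal
and antidiagonal classes is linear up to a translation. -/
theorem isMonomialAffine_of_preserves_diagonal [Finite W] (hp : Odd p) {f h : W → W} (c : W × W)
    (hf0 : f 0 = 0) (hh0 : h 0 = 0) (hf : Function.Injective f)
    (H : ∀ x x' y y', (x - x' = y - y' ∨ x - x' = -(y - y')) →
      (f x - f x' = h y - h y' ∨ f x - f x' = -(h y - h y')))
    {τ : W × W → W × W} (hτ : ∀ x y, τ (x, y) = (f x, h y) + c) :
    IsMonomialAffine (ZMod p) τ := by
  have h2 := eq_zero_of_add_self_eq_zero (W := W) hp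
  have hfh (x : W) : f x = h x ∨ f x = -h x := by
    simpa [hf0, hh0] using H x 0 x 0 (Or.inl rfl)
  have hhf (x : W) : h x = f x ∨ h x = -f x := by
    rcases hfh x with h1 | h1
    · exact Or.inl h1.symm
    · exact Or.inr (by rw [h1, neg_neg])
  have hh : Function.Injective h := by
    intro x y hxy
    rcases H x y x y (Or.inl rfl) with h1 | h1 <;> rw [hxy, sub_self] at h1
    · exact hf (sub_eq_zero.1 h1)
    · exact hf (sub_eq_zero.1 (by simpa using h1))
  have hfadd : ∀ x z, f (x + z) = f x + f z := by
    refine map_add_of_map_sub_eq_or h2 hf0 hf fun x z => ?_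
    -- This compares `(x + z, z)` with `(x, 0)`: the increment of `f` is `± h z`, which is `± f z`.
    have h1 := H (x + z) x z 0 (Or.inl (by abel))
    rw [hh0, sub_zero, sub_eq_iff_eq_add', sub_eq_iff_eq_add'] at h1
    rcases hhf z with h3 | h3 <;> rw [h3] at h1
    · rwa [← sub_eq_add_neg] at h1
    · rw [neg_neg, ← sub_eq_add_neg] at h1
      exact h1.symm
  have hhadd : ∀ x z, h (x + z) = h x + h z := by
    refine map_add_of_map_sub_eq_or h2 hh0 hh fun x z => ?_
    have h1 := H z 0 (x + z) x (Or.inl (by abel))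
    rw [hf0, sub_zero] at h1
    rcases hfh z with h3 | h3 <;> rw [h3] at h1
    · rcases h1 with h1 | h1
      · left; rw [h1]; abel
      · right; rw [h1]; abel
    · rcases h1 with h1 | h1
      · right; rw [eq_sub_iff_add_eq] at h1; rw [← h1]; abel
      · left; rw [neg_inj] at h1; rw [h1]; abel
  let g : W ≃ₗ[ZMod p] W := LinearEquiv.ofBijective
    (AddMonoidHom.toZModLinearMap p ⟨⟨f, hf0⟩, hfadd⟩) (Finite.injective_iff_bijective.1 hf)
  have hg (x : W) : g x = f x := rfl
  rcases eq_or_eq_neg_of_pointwise h2 hfadd hhadd hhf with h1 | h1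
  · exact ⟨g, 1, c, Or.inl rfl, Or.inl fun x y => by rw [hτ, h1, hg, hg, one_smul]⟩
  · exact ⟨g, -1, c, Or.inr rfl, Or.inl fun x y => by rw [hτ, h1, hg, hg, neg_smul, one_smul]⟩

theorem IsMonomialAffine.swap {τ : W × W → W × W} (h : IsMonomialAffine (ZMod p) τ) :
    IsMonomialAffine (ZMod p) fun z => (τ z).swap := by
  obtain ⟨g, ε, c, hε, h⟩ := h
  have hε2 : ε * ε = 1 := by rcases hε with rfl | rfl <;> simp
  have hε0 : ε ≠ 0 := by rintro rfl; simp at hε2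
  refine ⟨g.trans (LinearEquiv.smulOfNeZero (ZMod p) W ε hε0), ε, c.swap, hε, ?_⟩
  rcases h with h | h
  · exact Or.inr fun x y => by ext <;> simp [h, smul_smul, hε2]
  · exact Or.inl fun x y => by ext <;> simp [h, smul_smul, hε2]

/-- Sharing a coordinate is a union of orbitals. Together with the diagonal relation of
`IsMonomialAffine.diagonal_imp`, it is all that the 2-closure argument uses. -/
theorem IsMonomialAffine.grid_iff {τ : W × W → W × W} (h : IsMonomialAffine (ZMod p) τ)
    (z z' : W × W) :
    ((τ z).1 = (τ z').1 ∨ (τ z).2 = (τ z').2) ↔ (z.1 = z'.1 ∨ z.2 = z'.2) := by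
  obtain ⟨g, ε, c, hε, h⟩ := h
  have hε0 : ε ≠ 0 := by rintro rfl; simp at hε
  obtain ⟨x, y⟩ := z
  obtain ⟨x', y'⟩ := z'
  rcases h with h | h
  · simp [h, smul_right_inj hε0]
  · simp [h, smul_right_inj hε0, or_comm]

theorem IsMonomialAffine.diagonal_imp {τ : W × W → W × W} (h : IsMonomialAffine (ZMod p) τ)
    {x x' y y' : W} (hz : x - x' = y - y' ∨ x - x' = -(y - y')) :
    (τ (x, y)).1 - (τ (x', y')).1 = (τ (x, y)).2 - (τ (x', y')).2 ∨
      (τ (x, y)).1 - (τ (x', y')).1 = -((τ (x, y)).2 - (τ (x', y')).2) := by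
  obtain ⟨g, ε, c, hε, h⟩ := h
  rcases h with h | h <;> rcases hε with rfl | rfl <;>
    simp only [h, Prod.fst_add, Prod.snd_add, add_sub_add_right_eq_sub, one_smul, neg_smul,
      ← map_sub, neg_sub_neg, ← map_neg, g.injective.eq_iff] <;>
    grind

/-- A permutation of `W × W` that agrees on every pair of points with some monomial affine map is a
monomial affine map. -/
theorem isMonomialAffine_of_pairs [Finite W] (hp : Odd p) (hW : 6 < Nat.card W)
    (τ : Equiv.Perm (W × W))
    (H : ∀ z z', ∃ ρ, IsMonomialAffine (ZMod p) ρ ∧ ρ z = τ z ∧ ρ z' = τ z') :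
    IsMonomialAffine (ZMod p) τ := by
  have hgrid (z z' : W × W) :
      ((τ z).1 = (τ z').1 ∨ (τ z).2 = (τ z').2) ↔ (z.1 = z'.1 ∨ z.2 = z'.2) := by
    obtain ⟨ρ, hρ, h1, h2⟩ := H z z'
    rw [← h1, ← h2, hρ.grid_iff]
  have hdiag {x x' y y' : W} (hz : x - x' = y - y' ∨ x - x' = -(y - y')) :
      (τ (x, y)).1 - (τ (x', y')).1 = (τ (x, y)).2 - (τ (x', y')).2 ∨
        (τ (x, y)).1 - (τ (x', y')).1 = -((τ (x, y)).2 - (τ (x', y')).2) := by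
    obtain ⟨ρ, hρ, h1, h2⟩ := H (x, y) (x', y')
    rw [← h1, ← h2]
    exact hρ.diagonal_imp hz
  let v : Fin 2 → ZMod p × ZMod p := ![(1, 0), (0, 1)]
  have hv0 (z z' : W × W) : z - z' ∈ netClass W (v 0) ↔ z.2 = z'.2 := by
    rw [mem_netClass]; simp [v, sub_eq_zero, eq_comm]
  have hv1 (z z' : W × W) : z - z' ∈ netClass W (v 1) ↔ z.1 = z'.1 := by
    rw [mem_netClass]; simp [v, sub_eq_zero]
  obtain ⟨π, hπ, hτ⟩ := exists_map_netClass v (by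
      intro i j hij
      fin_cases i <;> fin_cases j <;> simp_all [v, planeDet]) (by simpa using hW) τ (by
      intro z z'
      simp only [Fin.exists_fin_two, hv0, hv1]
      rw [or_comm, hgrid, or_comm])
  -- The case in which neither coordinate class is moved: `τ` is a product of maps of the
  -- coordinates. If the classes are exchanged, `τ` is first composed with the swap.
  have key (τ : Equiv.Perm (W × W)) (h0 : ∀ z z', z.1 = z'.1 → (τ z).1 = (τ z').1)
      (h1 : ∀ z z', z.2 = z'.2 → (τ z).2 = (τ z').2)
      (hdiag : ∀ {x x' y y' : W}, (x - x' = y - y' ∨ x - x' = -(y - y')) →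
      (τ (x, y)).1 - (τ (x', y')).1 = (τ (x, y)).2 - (τ (x', y')).2 ∨
        (τ (x, y)).1 - (τ (x', y')).1 = -((τ (x, y)).2 - (τ (x', y')).2)) :
      IsMonomialAffine (ZMod p) τ := by
    have hx (x y : W) : (τ (x, y)).1 = (τ (x, 0)).1 := h0 _ _ rfl
    have hy (x y : W) : (τ (x, y)).2 = (τ (0, y)).2 := h1 _ _ rfl
    refine isMonomialAffine_of_preserves_diagonal hp (f := fun x => (τ (x, 0)).1 - (τ 0).1)
      (h := fun y => (τ (0, y)).2 - (τ 0).2) (τ 0) (sub_self _) (sub_self _) ?_ ?_ ?_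
    · intro x x' hxx
      have h3 : (τ (x, 0)).1 = (τ (x', 0)).1 := sub_left_injective hxx
      have h4 := τ.injective (Prod.ext h3 (h1 (x, 0) (x', 0) rfl))
      exact congrArg Prod.fst h4
    · intro x x' y y' h
      have h3 := hdiag h
      rw [hx x y, hx x' y', hy x y, hy x' y'] at h3
      simpa only [sub_sub_sub_cancel_right] using h3
    · intro x y
      ext
      · simp [hx x y]
      · simp [hy x y]
  by_cases h : π 0 = 0
  · have h' : π 1 = 1 := by
      have := hπ.ne (show (1 : Fin 2) ≠ 0 by decide)
      rw [h] at this
      omega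
    refine key τ (fun z z' hz => ?_) (fun z z' hz => ?_) hdiag
    · have := hτ 1 z z' ((hv1 _ _).2 hz)
      rwa [h', hv1] at this
    · have := hτ 0 z z' ((hv0 _ _).2 hz)
      rwa [h, hv0] at this
  · have h0 : π 0 = 1 := by omega
    have h' : π 1 = 0 := by
      have := hπ.ne (show (1 : Fin 2) ≠ 0 by decide)
      rw [h0] at this
      omega
    have h3 := key (τ.trans (Equiv.prodComm W W)) (fun z z' hz => ?_) (fun z z' hz => ?_)
      fun {x x' y y'} hz => ?_
    · simpa using h3.swap
    · have := hτ 1 z z' ((hv1 _ _).2 hz)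
      rw [h', hv0] at this
      simpa using this
    · have := hτ 0 z z' ((hv0 _ _).2 hz)
      rw [h0, hv1] at this
      simpa using this
    · have := hdiag hz
      simp only [Equiv.trans_apply, Equiv.prodComm_apply, Prod.fst_swap, Prod.snd_swap]
      rcases this with h | h
      · exact Or.inl h.symm
      · exact Or.inr (by rw [h, neg_neg])

theorem isTwoClosed_affineGroupG {V : Type*} [AddCommGroup V] [Module (ZMod p) V] [Finite W]
    (hp : Odd p) (hW : 6 < Nat.card W) (e : Module.Basis (Fin 2) (ZMod p) V) :
    IsTwoClosed (affineGroupG e W) := by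
  refine le_antisymm (fun σ hσ => ?_) fun σ hσ z => ⟨⟨σ, hσ⟩, rfl⟩
  rw [mem_affineGroupG_iff]
  refine isMonomialAffine_of_pairs hp hW
    ((tensorCoord e).symm.toEquiv.trans (σ.trans (tensorCoord e).toEquiv)) fun z z' => ?_
  obtain ⟨⟨ρ, hρ⟩, h⟩ := hσ ((tensorCoord e).symm z, (tensorCoord e).symm z')
  have h1 : ρ ((tensorCoord e).symm z) = σ ((tensorCoord e).symm z) := congrArg Prod.fst h
  have h2 : ρ ((tensorCoord e).symm z') = σ ((tensorCoord e).symm z') := congrArg Prod.snd h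
  exact ⟨_, (mem_affineGroupG_iff e ρ).1 hρ, by simp [h1], by simp [h2]⟩

end TwoClosed

/-! ### Rigid families of points and their digraphs -/

section Rigid

/-- The matrices `!![a, b; c, d]` that are scalar multiples of signed permutation matrices. -/
def IsMonomialMatrix {F : Type*} [Field F] (a b c d : F) : Prop :=
  (b = 0 ∧ c = 0 ∧ (d = a ∨ d = -a)) ∨ (a = 0 ∧ d = 0 ∧ (c = b ∨ c = -b))

/-- A family of plane vectors is rigid if every invertible matrix that permutes the lines they span
is a scalar multiple of a signed permutation matrix. -/
def IsRigidFamily {F ι : Type*} [Field F] (v : ι → F × F) : Prop :=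
  ∀ (a b c d : F) (π : ι → ι), Function.Injective π →
    (∀ x y, a * x + b * y = 0 → c * x + d * y = 0 → x = 0 ∧ y = 0) →
    (∀ i, planeDet (a * (v i).1 + b * (v i).2, c * (v i).1 + d * (v i).2) (v (π i)) = 0) →
    IsMonomialMatrix a b c d

theorem netClass_smul {F W : Type*} [Field F] [AddCommGroup W] [Module F W] {k : F} (hk : k ≠ 0)
    (v : F × F) : netClass W (k • v) = netClass W v := by
  ext z
  simp only [mem_netClass, Prod.smul_fst, Prod.smul_snd, smul_eq_mul, mul_smul]
  exact smul_right_inj hk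

variable {p : ℕ} [Fact p.Prime] {W : Type*} [AddCommGroup W] [Module (ZMod p) W]

/-- The net lemma gives `τ = M ⊗ f` plus a translation. Injectivity of `τ` makes `M` and `f`
injective, and applying `τ` to `v i ⊗ w` shows that `M` maps the line of `v i` to that of `v (π i)`.
-/
theorem IsRigidFamily.isMonomialAffine [Finite W] {ι : Type*} [Fintype ι]
    {v : ι → ZMod p × ZMod p} (hrigid : IsRigidFamily v)
    (hv : ∀ i j, i ≠ j → planeDet (v i) (v j) ≠ 0)
    {i j k : ι} (hij : i ≠ j) (hjk : j ≠ k) (hki : k ≠ i)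
    (hcard : Fintype.card ι ^ 2 + Fintype.card ι < Nat.card W) (τ : Equiv.Perm (W × W))
    (hτ : ∀ x y, (∃ i, τ x - τ y ∈ netClass W (v i)) ↔ ∃ i, x - y ∈ netClass W (v i)) :
    IsMonomialAffine (ZMod p) τ := by
  have : Nontrivial ι := ⟨i, j, hij⟩
  have : Nontrivial W := Finite.one_lt_card_iff_nontrivial.1 (by
    have := Fintype.card_pos_iff.2 ⟨i⟩
    omega)
  obtain ⟨w, hw⟩ := exists_ne (0 : W)
  obtain ⟨π, hπ, hmap⟩ := exists_map_netClass v hv hcard τ hτ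
  obtain ⟨f, a, b, c, d, hf⟩ := exists_matrix_of_map_netClass v hv τ hπ hmap hij hjk hki
  have hinj {x y : W} (h1 : a • f x + b • f y = 0) (h2 : c • f x + d • f y = 0) :
      x = 0 ∧ y = 0 := by
    have h : τ (x, y) = τ 0 := by rw [hf, h1, h2]; exact zero_add _
    simpa using τ.injective h
  have hfinj : Function.Injective f := by
    rw [injective_iff_map_eq_zero]
    intro x hx
    exact (hinj (x := x) (y := 0) (by simp [hx]) (by simp [hx])).1
  have hnondeg (x y : ZMod p) (h1 : a * x + b * y = 0) (h2 : c * x + d * y = 0) :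
      x = 0 ∧ y = 0 := by
    have := hinj (x := x • w) (y := y • w)
      (by rw [map_smul, map_smul, smul_smul, smul_smul, ← add_smul, h1, zero_smul])
      (by rw [map_smul, map_smul, smul_smul, smul_smul, ← add_smul, h2, zero_smul])
    simpa [hw] using this
  have hpar (i : ι) :
      planeDet (a * (v i).1 + b * (v i).2, c * (v i).1 + d * (v i).2) (v (π i)) = 0 := by
    have h := hmap i ((v i).1 • w, (v i).2 • w) 0 (by
      simp [mem_netClass, smul_smul, mul_comm])
    rw [hf, add_sub_cancel_right, mem_netClass] at h
    simp only [map_smul] at h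
    have hfw : f w ≠ 0 := fun h0 => hw (hfinj (by rw [h0, map_zero]))
    have h3 : planeDet (a * (v i).1 + b * (v i).2, c * (v i).1 + d * (v i).2) (v (π i)) • f w
        = 0 := by
      unfold planeDet
      linear_combination (norm := module) h
    exact (smul_eq_zero_iff_left hfw).1 h3
  let g (s : ZMod p) (hs : s ≠ 0) : W ≃ₗ[ZMod p] W :=
    (LinearEquiv.ofBijective f (Finite.injective_iff_bijective.1 hfinj)).trans
      (LinearEquiv.smulOfNeZero (ZMod p) W s hs)
  have hg (s : ZMod p) (hs : s ≠ 0) (x : W) : g s hs x = s • f x := rfl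
  rcases hrigid a b c d π hπ hnondeg hpar with ⟨rfl, rfl, h⟩ | ⟨rfl, rfl, h⟩
  · have ha : a ≠ 0 := by
      rintro rfl
      simpa using hnondeg 1 0
    rcases h with rfl | rfl
    · exact ⟨g d ha, 1, τ 0, Or.inl rfl, Or.inl fun x y => by simp [hf x y, hg]⟩
    · exact ⟨g a ha, -1, τ 0, Or.inr rfl, Or.inl fun x y => by simp [hf x y, hg]⟩
  · have hb : b ≠ 0 := by
      rintro rfl
      simpa using hnondeg 0 1
    rcases h with rfl | rfl
    · exact ⟨g c hb, 1, τ 0, Or.inl rfl, Or.inr fun x y => by simp [hf x y, hg]⟩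
    · exact ⟨g b hb, -1, τ 0, Or.inr rfl, Or.inr fun x y => by simp [hf x y, hg]⟩

/-- The hypotheses `hneg` and `hswap` say that the lines spanned by the family are permuted by the
generators of `D₈`. -/
theorem IsMonomialAffine.exists_mem_netClass {ι : Type*} {v : ι → ZMod p × ZMod p}
    (hneg : ∀ i, ∃ (j : ι) (k : ZMod p), k ≠ 0 ∧ ((v i).1, -(v i).2) = k • v j)
    (hswap : ∀ i, ∃ (j : ι) (k : ZMod p), k ≠ 0 ∧ ((v i).2, (v i).1) = k • v j)
    {τ : W × W → W × W} (hτ : IsMonomialAffine (ZMod p) τ) {x y : W × W}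
    (h : ∃ i, x - y ∈ netClass W (v i)) : ∃ i, τ x - τ y ∈ netClass W (v i) := by
  have hneg' (i : ι) : ∃ j, netClass W ((v i).1, -(v i).2) = netClass W (v j) := by
    obtain ⟨j, k, hk, h⟩ := hneg i
    exact ⟨j, by rw [h, netClass_smul hk]⟩
  have hswap' (i : ι) : ∃ j, netClass W ((v i).2, (v i).1) = netClass W (v j) := by
    obtain ⟨j, k, hk, h⟩ := hswap i
    exact ⟨j, by rw [h, netClass_smul hk]⟩
  have hmul {ε : ZMod p} (hε : ε = 1 ∨ ε = -1) (i : ι) :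
      ∃ j, netClass W ((v i).1, ε * (v i).2) = netClass W (v j) := by
    rcases hε with rfl | rfl
    · exact ⟨i, by rw [one_mul]⟩
    · simpa using hneg' i
  obtain ⟨g, ε, c, hε, hτ⟩ := hτ
  obtain ⟨i, h⟩ := h
  obtain ⟨x, x'⟩ := x
  obtain ⟨y, y'⟩ := y
  simp only [mem_netClass, Prod.mk_sub_mk] at h
  have hg := congrArg g h
  rw [map_smul, map_smul, map_sub, map_sub] at hg
  rcases hτ with hτ | hτ
  · obtain ⟨j, hj⟩ := hmul hε i
    refine ⟨j, ?_⟩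
    rw [← hj, mem_netClass, hτ, hτ, add_sub_add_right_eq_sub, Prod.mk_sub_mk]
    linear_combination (norm := module) ε • hg
  · obtain ⟨i', hi'⟩ := hswap' i
    have hi : (g x' - g y', g x - g y) ∈ netClass W (v i') := by
      rw [← hi', mem_netClass]
      exact hg.symm
    rw [mem_netClass] at hi
    obtain ⟨j, hj⟩ := hmul hε i'
    refine ⟨j, ?_⟩
    rw [← hj, mem_netClass, hτ, hτ, add_sub_add_right_eq_sub, Prod.mk_sub_mk]
    linear_combination (norm := module) ε • hi

theorem IsRigidFamily.isDigraphAut {V : Type*} [AddCommGroup V] [Module (ZMod p) V] [Finite W]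
    {ι : Type*} [Fintype ι] {v : ι → ZMod p × ZMod p} (hrigid : IsRigidFamily v)
    (e : Module.Basis (Fin 2) (ZMod p) V)
    (hv : ∀ i j, i ≠ j → planeDet (v i) (v j) ≠ 0)
    (hneg : ∀ i, ∃ (j : ι) (k : ZMod p), k ≠ 0 ∧ ((v i).1, -(v i).2) = k • v j)
    (hswap : ∀ i, ∃ (j : ι) (k : ZMod p), k ≠ 0 ∧ ((v i).2, (v i).1) = k • v j)
    {i j k : ι} (hij : i ≠ j) (hjk : j ≠ k) (hki : k ≠ i)
    (hcard : Fintype.card ι ^ 2 + Fintype.card ι < Nat.card W) :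
    IsDigraphAut (affineGroupG e W) := by
  let R : V ⊗[ZMod p] W → V ⊗[ZMod p] W → Prop := fun x y =>
    ∃ i, tensorCoord e x - tensorCoord e y ∈ netClass W (v i)
  have hmono (σ : Equiv.Perm (V ⊗[ZMod p] W)) (hσ : σ ∈ affineGroupG e W)
      (x y : V ⊗[ZMod p] W) (h : R x y) : R (σ x) (σ y) := by
    have h1 := ((mem_affineGroupG_iff e σ).1 hσ).exists_mem_netClass hneg hswap h
    simpa only [LinearEquiv.symm_apply_apply] using h1
  refine ⟨⟨fun x y => x ≠ y ∧ R x y⟩, fun x h => h.1 rfl, le_antisymm (fun σ hσ => ?_)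
    fun σ hσ x y => ?_⟩
  · rw [mem_affineGroupG_iff]
    refine hrigid.isMonomialAffine hv hij hjk hki hcard
      ((tensorCoord e).symm.toEquiv.trans (σ.trans (tensorCoord e).toEquiv)) fun x y => ?_
    -- The net relation is reflexive but the digraph has no loops, so equal points are treated
    -- apart.
    by_cases hxy : x = y
    · subst hxy
      simp only [sub_self, zero_mem]
    · have h1 := hσ ((tensorCoord e).symm x) ((tensorCoord e).symm y)
      simpa [R, hxy] using h1
  · refine and_congr (by simp) ⟨fun h => ?_, hmono σ hσ x y⟩
    simpa using hmono σ⁻¹ (inv_mem hσ) _ _ h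

end Rigid

/-! ### Rigidity of four points, by cross ratio -/

section FourPoints

variable {F : Type*} [Field F]

/-- The four plane vectors `(t, ± 1)`, `(1, ± t)`. -/
def fourPoints (t : F) : Fin 4 → F × F := ![(t, 1), (t, -1), (1, t), (1, -t)]

theorem exists_smul_of_planeDet_eq_zero {u v : F × F} (hv : v ≠ 0) (h : planeDet u v = 0) :
    ∃ s : F, u = s • v := by
  unfold planeDet at h
  by_cases h1 : v.1 = 0
  · have h2 : v.2 ≠ 0 := fun h2 => hv (Prod.ext h1 h2)
    refine ⟨u.2 / v.2, Prod.ext ?_ ?_⟩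
    · simp only [Prod.smul_fst, smul_eq_mul, h1, mul_zero, sub_zero] at h ⊢
      exact (mul_eq_zero.1 h).resolve_right h2
    · simp [h2]
  · refine ⟨u.1 / v.1, Prod.ext ?_ ?_⟩
    · simp [h1]
    · simp only [Prod.smul_snd, smul_eq_mul]
      field_simp
      linear_combination -h

/-- `h` says that the permuted points have the cross ratio `((t² - 1) / (t² + 1))²` of the original
ones. The Klein four-group always preserves it. Any other permutation does so only for a cross ratio
`-1`, `1/2` or `2`, excluded by `h1`, `h2`, `h4`, or an equianharmonic one, excluded by `h3`;
degenerate factors are excluded too. -/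
theorem fourPoints_rigid_aux {t : F} (h1 : 8 * t ^ 2 * (t ^ 4 + 1) ≠ 0)
    (h2 : (t ^ 2 + 1) ^ 2 * (t ^ 4 - 6 * t ^ 2 + 1) ≠ 0)
    (h3 : t ^ 8 + 14 * t ^ 4 + 1 ≠ 0)
    (h4 : (t ^ 2 - 1) ^ 2 * (t ^ 4 + 6 * t ^ 2 + 1) ≠ 0) {i j k l : Fin 4}
    (hij : i ≠ j) (hik : i ≠ k) (hil : i ≠ l) (hjk : j ≠ k) (hjl : j ≠ l) (hkl : k ≠ l)
    (h : (t ^ 2 + 1) ^ 2 * planeDet (fourPoints t i) (fourPoints t k) *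
        planeDet (fourPoints t j) (fourPoints t l) -
      (t ^ 2 - 1) ^ 2 * planeDet (fourPoints t j) (fourPoints t k) *
        planeDet (fourPoints t i) (fourPoints t l) = 0) :
    (i, j, k, l) ∈ [((0 : Fin 4), (1 : Fin 4), (2 : Fin 4), (3 : Fin 4)), (1, 0, 3, 2),
      (2, 3, 0, 1), (3, 2, 1, 0)] := by
  fin_cases i <;> fin_cases j <;> first | exact absurd rfl hij | skip
  all_goals fin_cases k <;> first | exact absurd rfl hik | exact absurd rfl hjk | skip
  all_goals
    fin_cases l <;>
      first | exact absurd rfl hil | exact absurd rfl hjl | exact absurd rfl hkl | skip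
  all_goals
    first
      | decide
      | (exfalso
         simp only [fourPoints, planeDet, Fin.zero_eta, Fin.mk_one, Fin.reduceFinMk,
           Matrix.cons_val] at h
         first
           | exact h1 (by linear_combination -h)
           | exact h2 (by linear_combination -h)
           | exact h3 (by linear_combination h)
           | exact h3 (by linear_combination -h)
           | exact h4 (by linear_combination h))

/-- A matrix fixing more than two points of the projective line is scalar. -/
theorem fourPoints_stabilizer {t a b c d : F} (h2 : (2 : F) ≠ 0) (ht : t ≠ 0) (h4 : t ^ 4 - 1 ≠ 0)
    (e0 : a * t + b = t * (c * t + d)) (e1 : a * t - b = -(t * (c * t - d)))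
    (e2 : t * (a + b * t) = c + d * t) (e3 : t * (a - b * t) = -(c - d * t)) :
    b = 0 ∧ c = 0 ∧ d = a := by
  have hb : b = 0 := by
    have h : 2 * (t ^ 4 - 1) * b = 0 := by
      linear_combination t ^ 2 * e2 - t ^ 2 * e3 - e0 + e1
    exact (mul_eq_zero.1 h).resolve_left (mul_ne_zero h2 h4)
  subst hb
  refine ⟨rfl, ?_, ?_⟩
  · have h : 2 * c = 0 := by linear_combination e3 - e2
    exact (mul_eq_zero.1 h).resolve_left h2
  · have h : 2 * t * (d - a) = 0 := by linear_combination -e0 - e1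
    exact sub_eq_zero.1 ((mul_eq_zero.1 h).resolve_left (mul_ne_zero h2 ht))

theorem isRigidFamily_fourPoints {t : F} (h0 : (2 : F) ≠ 0) (ht : t ≠ 0) (h1 : t ^ 4 - 1 ≠ 0)
    (h2 : t ^ 4 + 1 ≠ 0) (h3 : t ^ 4 - 6 * t ^ 2 + 1 ≠ 0) (h4 : t ^ 4 + 6 * t ^ 2 + 1 ≠ 0)
    (h5 : t ^ 8 + 14 * t ^ 4 + 1 ≠ 0) : IsRigidFamily (fourPoints t) := by
  intro a b c d π hπ hnondeg hpar
  have hu : t ^ 2 + 1 ≠ 0 := fun h => h1 (by linear_combination (t ^ 2 - 1) * h)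
  have hw : t ^ 2 - 1 ≠ 0 := fun h => h1 (by linear_combination (t ^ 2 + 1) * h)
  have hne (i : Fin 4) : fourPoints t i ≠ 0 := by
    fin_cases i <;> simp [fourPoints, ht]
  obtain ⟨s, hs⟩ := exists_smul_of_planeDet_eq_zero (hne _) (hpar 0)
  obtain ⟨r, hr⟩ := exists_smul_of_planeDet_eq_zero (hne _) (hpar 1)
  have hs0 : s ≠ 0 := by
    rintro rfl
    rw [zero_smul, Prod.mk_eq_zero] at hs
    exact ht (hnondeg _ _ hs.1 hs.2).1
  have hs1 := congrArg Prod.fst hs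
  have hs2 := congrArg Prod.snd hs
  have hr1 := congrArg Prod.fst hr
  have hr2 := congrArg Prod.snd hr
  have p0 := hpar 0
  have p1 := hpar 1
  have p2 := hpar 2
  have p3 := hpar 3
  have v0 : fourPoints t 0 = (t, 1) := rfl
  have v1 : fourPoints t 1 = (t, -1) := rfl
  have v2 : fourPoints t 2 = (1, t) := rfl
  have v3 : fourPoints t 3 = (1, -t) := rfl
  simp only [v0, v1, Prod.smul_fst, Prod.smul_snd, smul_eq_mul] at hs1 hs2 hr1 hr2
  simp only [v0, v1, v2, v3, planeDet] at p0 p1 p2 p3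
  have key := fourPoints_rigid_aux (t := t) (i := π 0) (j := π 1) (k := π 2) (l := π 3)
    (by
      have : (8 : F) ≠ 0 := by
        have := pow_ne_zero 3 h0
        norm_num at this
        exact this
      exact mul_ne_zero (mul_ne_zero this (pow_ne_zero 2 ht)) h2)
    (mul_ne_zero (pow_ne_zero 2 hu) h3) h5 (mul_ne_zero (pow_ne_zero 2 hw) h4)
    (hπ.ne (by decide)) (hπ.ne (by decide)) (hπ.ne (by decide)) (hπ.ne (by decide))
    (hπ.ne (by decide)) (hπ.ne (by decide)) ?_
  · simp only [List.mem_cons, Prod.mk.injEq, List.not_mem_nil, or_false] at key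
    -- Each Klein permutation is induced by a signed permutation matrix; changing signs of rows or
    -- exchanging rows reduces it to the identity.
    rcases key with ⟨q0, q1, q2, q3⟩ | ⟨q0, q1, q2, q3⟩ | ⟨q0, q1, q2, q3⟩ | ⟨q0, q1, q2, q3⟩ <;>
      simp only [q0, q1, q2, q3, v0, v1, v2, v3] at p0 p1 p2 p3
    · obtain ⟨hb, hc, hd⟩ := fourPoints_stabilizer (a := a) (b := b) (c := c) (d := d) h0 ht h1
        (by linear_combination p0) (by linear_combination -p1) (by linear_combination p2)
        (by linear_combination -p3)
      exact Or.inl ⟨hb, hc, Or.inl hd⟩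
    · obtain ⟨hb, hc, hd⟩ := fourPoints_stabilizer (a := a) (b := b) (c := -c) (d := -d) h0 ht h1
        (by linear_combination -p0) (by linear_combination p1) (by linear_combination -p2)
        (by linear_combination p3)
      exact Or.inl ⟨hb, neg_eq_zero.1 hc, Or.inr (neg_eq_iff_eq_neg.1 hd)⟩
    · obtain ⟨hb, hc, hd⟩ := fourPoints_stabilizer (a := c) (b := d) (c := a) (d := b) h0 ht h1
        (by linear_combination -p0) (by linear_combination -p1) (by linear_combination -p2)
        (by linear_combination -p3)
      exact Or.inr ⟨hc, hb, Or.inl hd.symm⟩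
    · obtain ⟨hb, hc, hd⟩ := fourPoints_stabilizer (a := -c) (b := -d) (c := a) (d := b) h0 ht h1
        (by linear_combination p0) (by linear_combination p1) (by linear_combination p2)
        (by linear_combination p3)
      exact Or.inr ⟨hc, neg_eq_zero.1 hb, Or.inr (by rw [hd, neg_neg])⟩
  · apply (mul_eq_zero.1 _).resolve_left hs0
    -- `2t v₂ = (t² + 1) v₀ - (t² - 1) v₁` and `2t v₃ = -(t² - 1) v₀ + (t² + 1) v₁`. Applying the
    -- matrix and eliminating `r` leaves the cross ratio equation times `s`.
    have E2 : (t ^ 2 + 1) * s * planeDet (fourPoints t (π 0)) (fourPoints t (π 2)) -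
        (t ^ 2 - 1) * r * planeDet (fourPoints t (π 1)) (fourPoints t (π 2)) = 0 := by
      unfold planeDet
      linear_combination 2 * t * p2 -
        (fourPoints t (π 2)).2 * ((t ^ 2 + 1) * hs1 - (t ^ 2 - 1) * hr1) +
        (fourPoints t (π 2)).1 * ((t ^ 2 + 1) * hs2 - (t ^ 2 - 1) * hr2)
    have E3 : -((t ^ 2 - 1) * s * planeDet (fourPoints t (π 0)) (fourPoints t (π 3))) +
        (t ^ 2 + 1) * r * planeDet (fourPoints t (π 1)) (fourPoints t (π 3)) = 0 := by
      unfold planeDet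
      linear_combination 2 * t * p3 -
        (fourPoints t (π 3)).2 * (-(t ^ 2 - 1) * hs1 + (t ^ 2 + 1) * hr1) +
        (fourPoints t (π 3)).1 * (-(t ^ 2 - 1) * hs2 + (t ^ 2 + 1) * hr2)
    linear_combination (t ^ 2 + 1) * planeDet (fourPoints t (π 1)) (fourPoints t (π 3)) * E2 +
      (t ^ 2 - 1) * planeDet (fourPoints t (π 1)) (fourPoints t (π 2)) * E3

end FourPoints

/-! ### Six rigid points over the field of order 17 -/

section SixPoints

/-- The six plane vectors over the field of order `17` given by the coordinate axes and the four
vectors `(1, ± 3)`, `(± 3, 1)`. -/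
def sixPoints : Fin 6 → ZMod 17 × ZMod 17 := ![(1, 0), (0, 1), (1, 3), (1, -3), (3, 1), (-3, 1)]

/-- The sextic form that vanishes on the lines spanned by `sixPoints`. -/
def sexticForm (x y : ZMod 17) : ZMod 17 := x * y * (x ^ 2 - 9 * y ^ 2) * (9 * x ^ 2 - y ^ 2)

-- A finite check, for matrices scaled to have first entry 1. The condition on `c` comes first and
-- leaves five values, which keeps the search small.
set_option maxRecDepth 100000 in
theorem sexticForm_stabilizer : ∀ c : ZMod 17, sexticForm 1 c = 0 →
    ∀ b d : ZMod 17, sexticForm b d = 0 → d - b * c ≠ 0 →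
      sexticForm (1 + b * 3) (c + d * 3) = 0 → sexticForm (1 + b * -3) (c + d * -3) = 0 →
      sexticForm (3 + b) (c * 3 + d) = 0 → sexticForm (-3 + b) (c * -3 + d) = 0 →
      b = 0 ∧ c = 0 ∧ (d = 1 ∨ d = -1) := by
  decide

theorem sixPoints_independent : ∀ i j, i ≠ j →
    (sixPoints i).1 * (sixPoints j).2 - (sixPoints i).2 * (sixPoints j).1 ≠ 0 := by
  decide

variable [Fact (Nat.Prime 17)]

theorem sexticForm_eq_zero {x y : ZMod 17} {j : Fin 6} (h : planeDet (x, y) (sixPoints j) = 0) :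
    sexticForm x y = 0 := by
  unfold sexticForm
  unfold planeDet sixPoints at h
  fin_cases j <;> simp only [Fin.zero_eta, Fin.mk_one, Fin.reduceFinMk, Matrix.cons_val] at h
  · linear_combination -x * (x ^ 2 - 9 * y ^ 2) * (9 * x ^ 2 - y ^ 2) * h
  · linear_combination y * (x ^ 2 - 9 * y ^ 2) * (9 * x ^ 2 - y ^ 2) * h
  · linear_combination x * y * (x ^ 2 - 9 * y ^ 2) * (3 * x + y) * h
  · linear_combination -x * y * (x ^ 2 - 9 * y ^ 2) * (3 * x - y) * h
  · linear_combination x * y * (x + 3 * y) * (9 * x ^ 2 - y ^ 2) * h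
  · linear_combination x * y * (x - 3 * y) * (9 * x ^ 2 - y ^ 2) * h

theorem sexticForm_div {x y a : ZMod 17} (h : sexticForm x y = 0) :
    sexticForm (x / a) (y / a) = 0 := by
  unfold sexticForm at h ⊢
  linear_combination (a⁻¹) ^ 6 * h

theorem sexticForm_swap {x y : ZMod 17} (h : sexticForm x y = 0) : sexticForm y x = 0 := by
  unfold sexticForm at h ⊢
  linear_combination h

theorem sexticForm_stabilizer_of_ne_zero {a b c d : ZMod 17} (ha : a ≠ 0)
    (hdet : a * d - b * c ≠ 0)
    (h0 : sexticForm a c = 0) (h1 : sexticForm b d = 0)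
    (h2 : sexticForm (a + b * 3) (c + d * 3) = 0) (h3 : sexticForm (a + b * -3) (c + d * -3) = 0)
    (h4 : sexticForm (a * 3 + b) (c * 3 + d) = 0)
    (h5 : sexticForm (a * -3 + b) (c * -3 + d) = 0) :
    b = 0 ∧ c = 0 ∧ (d = a ∨ d = -a) := by
  replace h0 := sexticForm_div (a := a) h0
  replace h1 := sexticForm_div (a := a) h1
  replace h2 := sexticForm_div (a := a) h2
  replace h3 := sexticForm_div (a := a) h3
  replace h4 := sexticForm_div (a := a) h4
  replace h5 := sexticForm_div (a := a) h5
  simp only [add_div, mul_div_right_comm, div_self ha, one_mul] at h0 h2 h3 h4 h5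
  have hdet' : d / a - b / a * (c / a) ≠ 0 := by
    have : d / a - b / a * (c / a) = (a * d - b * c) / a ^ 2 := by field_simp
    rw [this]
    exact div_ne_zero hdet (pow_ne_zero 2 ha)
  obtain ⟨hb, hc, hd⟩ := sexticForm_stabilizer _ h0 _ _ h1 hdet' h2 h3 h4 h5
  refine ⟨by simpa [ha] using hb, by simpa [ha] using hc, ?_⟩
  rw [div_eq_one_iff_eq ha, div_eq_iff ha, neg_one_mul] at hd
  exact hd

theorem isRigidFamily_sixPoints : IsRigidFamily sixPoints := by
  intro a b c d π _ hnondeg hpar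
  have hdet : a * d - b * c ≠ 0 := by
    intro h
    obtain ⟨h1, h2⟩ := hnondeg d (-c) (by linear_combination h) (by ring)
    obtain ⟨h3, h4⟩ := hnondeg b (-a) (by ring) (by linear_combination -h)
    have ha : a = 0 := neg_eq_zero.1 h4
    have hc : c = 0 := neg_eq_zero.1 h2
    exact one_ne_zero (hnondeg 1 0 (by simp [ha]) (by simp [hc])).1
  have h0 := sexticForm_eq_zero (hpar 0)
  have h1 := sexticForm_eq_zero (hpar 1)
  have h2 := sexticForm_eq_zero (hpar 2)
  have h3 := sexticForm_eq_zero (hpar 3)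
  have h4 := sexticForm_eq_zero (hpar 4)
  have h5 := sexticForm_eq_zero (hpar 5)
  have v0 : sixPoints 0 = (1, 0) := rfl
  have v1 : sixPoints 1 = (0, 1) := rfl
  have v2 : sixPoints 2 = (1, 3) := rfl
  have v3 : sixPoints 3 = (1, -3) := rfl
  have v4 : sixPoints 4 = (3, 1) := rfl
  have v5 : sixPoints 5 = (-3, 1) := rfl
  simp only [v0, v1, v2, v3, v4, v5, mul_one, mul_zero, add_zero, zero_add] at h0 h1 h2 h3 h4 h5
  -- The sextic is symmetric up to sign, so the rows may be exchanged to make the first entry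
  -- nonzero.
  by_cases ha : a = 0
  · have hc : c ≠ 0 := by
      rintro rfl
      exact hdet (by rw [ha]; ring)
    obtain ⟨h6, h7, h8⟩ := sexticForm_stabilizer_of_ne_zero hc
      (fun h => hdet (by linear_combination -h)) (sexticForm_swap h0) (sexticForm_swap h1)
      (sexticForm_swap h2) (sexticForm_swap h3) (sexticForm_swap h4) (sexticForm_swap h5)
    refine Or.inr ⟨h7, h6, ?_⟩
    rcases h8 with h8 | h8
    · exact Or.inl h8.symm
    · exact Or.inr (by rw [h8, neg_neg])
  · exact Or.inl (sexticForm_stabilizer_of_ne_zero ha hdet h0 h1 h2 h3 h4 h5)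

end SixPoints

/-! ### Digraphs for the remaining primes -/

section Existence

variable {p : ℕ} [Fact p.Prime] {V W : Type*} [AddCommGroup V] [Module (ZMod p) V]
  [AddCommGroup W] [Module (ZMod p) W] [Finite W]

/-- The bound 20 is `4² + 4`, from the net lemma with four classes. -/
theorem isDigraphAut_of_fourPoints (e : Module.Basis (Fin 2) (ZMod p) V) (hW : 20 < Nat.card W)
    {t : ZMod p} (h0 : (2 : ZMod p) ≠ 0) (ht : t ≠ 0) (h1 : t ^ 4 - 1 ≠ 0)
    (h2 : t ^ 4 + 1 ≠ 0) (h3 : t ^ 4 - 6 * t ^ 2 + 1 ≠ 0) (h4 : t ^ 4 + 6 * t ^ 2 + 1 ≠ 0)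
    (h5 : t ^ 8 + 14 * t ^ 4 + 1 ≠ 0) : IsDigraphAut (affineGroupG e W) := by
  have hu : t ^ 2 + 1 ≠ 0 := fun h => h1 (by linear_combination (t ^ 2 - 1) * h)
  have hw : t ^ 2 - 1 ≠ 0 := fun h => h1 (by linear_combination (t ^ 2 + 1) * h)
  have h2t : 2 * t ≠ 0 := mul_ne_zero h0 ht
  refine (isRigidFamily_fourPoints h0 ht h1 h2 h3 h4 h5).isDigraphAut e ?_ ?_ ?_
    (i := 0) (j := 1) (k := 2) (by decide) (by decide) (by decide) (by simpa using hW)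
  · intro i j hij h
    unfold planeDet fourPoints at h
    fin_cases i <;> fin_cases j <;> first
      | exact hij rfl
      | (simp only [Fin.zero_eta, Fin.mk_one, Fin.reduceFinMk, Matrix.cons_val] at h
         first
           | exact h2t (by linear_combination h)
           | exact h2t (by linear_combination -h)
           | exact hu (by linear_combination h)
           | exact hu (by linear_combination -h)
           | exact hw (by linear_combination h)
           | exact hw (by linear_combination -h))
  · intro i
    fin_cases i
    · exact ⟨1, 1, one_ne_zero, by simp [fourPoints]⟩
    · exact ⟨0, 1, one_ne_zero, by simp [fourPoints]⟩
    · exact ⟨3, 1, one_ne_zero, by simp [fourPoints]⟩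
    · exact ⟨2, 1, one_ne_zero, by simp [fourPoints]⟩
  · intro i
    fin_cases i
    · exact ⟨2, 1, one_ne_zero, by simp [fourPoints]⟩
    · exact ⟨3, -1, by simp, by simp [fourPoints]⟩
    · exact ⟨0, 1, one_ne_zero, by simp [fourPoints]⟩
    · exact ⟨1, -1, by simp, by simp [fourPoints]⟩

theorem isDigraphAut_seventeen [Fact (Nat.Prime 17)] {V W : Type*} [AddCommGroup V]
    [Module (ZMod 17) V] [AddCommGroup W] [Module (ZMod 17) W] [Finite W]
    (e : Module.Basis (Fin 2) (ZMod 17) V) (hW : 42 < Nat.card W) :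
    IsDigraphAut (affineGroupG e W) := by
  refine isRigidFamily_sixPoints.isDigraphAut e ?_ ?_ ?_
    (i := 0) (j := 1) (k := 2) (by decide) (by decide) (by decide) (by simpa using hW)
  · exact sixPoints_independent
  · intro i
    fin_cases i
    · exact ⟨0, 1, one_ne_zero, by simp [sixPoints]⟩
    · exact ⟨1, -1, by simp, by simp [sixPoints]⟩
    · exact ⟨3, 1, one_ne_zero, by simp [sixPoints]⟩
    · exact ⟨2, 1, one_ne_zero, by simp [sixPoints]⟩
    · exact ⟨5, -1, by simp, by simp [sixPoints]⟩
    · exact ⟨4, -1, by simp, by simp [sixPoints]⟩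
  · intro i
    fin_cases i
    · exact ⟨1, 1, one_ne_zero, by simp [sixPoints]⟩
    · exact ⟨0, 1, one_ne_zero, by simp [sixPoints]⟩
    · exact ⟨4, 1, one_ne_zero, by simp [sixPoints]⟩
    · exact ⟨5, 1, one_ne_zero, by simp [sixPoints]⟩
    · exact ⟨2, 1, one_ne_zero, by simp [sixPoints]⟩
    · exact ⟨3, 1, one_ne_zero, by simp [sixPoints]⟩

theorem isDigraphAut_affineGroupG (hp : Odd p) (hp3 : p ≠ 3) (hp5 : p ≠ 5) (hp7 : p ≠ 7)
    (hp13 : p ≠ 13) (e : Module.Basis (Fin 2) (ZMod p) V) (hW : p ^ 2 ≤ Nat.card W) :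
    IsDigraphAut (affineGroupG e W) := by
  have hprime : p.Prime := Fact.out
  have h11 : 11 ≤ p := by
    by_contra! h
    interval_cases p <;> simp_all +decide
  have hcard : 20 < Nat.card W := by nlinarith
  have hcast (n : ℕ) (h : ∀ q, q.Prime → q ∣ n → q ≠ p) : (n : ZMod p) ≠ 0 := by
    rw [Ne, ZMod.natCast_eq_zero_iff]
    exact fun hd => h p hprime hd rfl
  have hpr {q r : ℕ} (hr : r.Prime) (hq : q.Prime) (h : q ∣ r) : q = r :=
    (Nat.prime_dvd_prime_iff_eq hq hr).1 h
  -- Over the field of order 17 every four-point orbit `{± t, ± 1/t}` has a harmonic cross ratio, so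
  -- six points are needed.
  by_cases h17 : p = 17
  · subst h17
    exact isDigraphAut_seventeen e (by omega)
  by_cases h37 : p = 37 ∨ p = 41
  · have hn (n : ℕ) (h : ¬ 37 ∣ n) (h' : ¬ 41 ∣ n) : (n : ZMod p) ≠ 0 := by
      rw [Ne, ZMod.natCast_eq_zero_iff]
      rcases h37 with rfl | rfl <;> assumption
    have n2 := hn 2 (by decide) (by decide)
    have n4 := hn 4 (by decide) (by decide)
    have n255 := hn 255 (by decide) (by decide)
    have n257 := hn 257 (by decide) (by decide)
    have n161 := hn 161 (by decide) (by decide)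
    have n353 := hn 353 (by decide) (by decide)
    have n69121 := hn 69121 (by norm_num) (by norm_num)
    push_cast at n2 n4 n255 n257 n161 n353 n69121
    refine isDigraphAut_of_fourPoints e hcard (t := 4) n2 n4 ?_ ?_ ?_ ?_ ?_
    · intro h; exact n255 (by linear_combination h)
    · intro h; exact n257 (by linear_combination h)
    · intro h; exact n161 (by linear_combination h)
    · intro h; exact n353 (by linear_combination h)
    · intro h; exact n69121 (by linear_combination h)
  rw [not_or] at h37
  have n2 : ((2 : ℕ) : ZMod p) ≠ 0 := hcast 2 fun q hq hd => by
    rw [hpr Nat.prime_two hq hd]; omega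
  have n7 : ((7 : ℕ) : ZMod p) ≠ 0 := hcast 7 fun q hq hd => by
    rw [hpr (by norm_num) hq hd]; omega
  have n17 : ((17 : ℕ) : ZMod p) ≠ 0 := hcast 17 fun q hq hd => by
    rw [hpr (by norm_num) hq hd]; omega
  have n41 : ((41 : ℕ) : ZMod p) ≠ 0 := hcast 41 fun q hq hd => by
    rw [hpr (by norm_num) hq hd]; omega
  have n15 : ((3 * 5 : ℕ) : ZMod p) ≠ 0 := hcast (3 * 5) fun q hq hd => by
    rcases (Nat.Prime.dvd_mul hq).1 hd with h | h <;> rw [hpr (by norm_num) hq h] <;> omega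
  have n481 : ((13 * 37 : ℕ) : ZMod p) ≠ 0 := hcast (13 * 37) fun q hq hd => by
    rcases (Nat.Prime.dvd_mul hq).1 hd with h | h <;> rw [hpr (by norm_num) hq h] <;> omega
  push_cast at n2 n7 n17 n41 n15 n481
  -- At `t = 2` the conditions involve 2, 15, 17, -7, 41 and `481 = 13 · 37`, whose prime factors
  -- have all been excluded.
  refine isDigraphAut_of_fourPoints e hcard (t := 2) n2 n2 ?_ ?_ ?_ ?_ ?_
  · intro h; exact n15 (by linear_combination h)
  · intro h; exact n17 (by linear_combination h)
  · intro h; exact n7 (by linear_combination -h)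
  · intro h; exact n41 (by linear_combination h)
  · intro h; exact n481 (by linear_combination h)

end Existence

/-! ### Connection sets and their extra symmetries -/

theorem exists_linearEquiv_of_linearIndependent {K W ι : Type*} [Field K] [AddCommGroup W]
    [Module K W] [Finite ι] {v v' : ι → W} (hv : LinearIndependent K v)
    (hv' : LinearIndependent K v') : ∃ g : W ≃ₗ[K] W, ∀ i, g (v i) = v' i := by
  let b := Module.Basis.span hv
  let b' := Module.Basis.span hv'
  have : FiniteDimensional K (Submodule.span K (Set.range v)) := b.finiteDimensional_of_finite
  obtain ⟨g, hg⟩ := Submodule.exists_linearEquiv_restrict_eq (b.equiv b' (Equiv.refl ι))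
  refine ⟨g, fun i => ?_⟩
  have h := hg (b i)
  rw [Module.Basis.equiv_apply, Equiv.refl_apply] at h
  simpa [b, b', Module.Basis.span_apply] using h.symm

section Invariant

variable {F V W : Type*} [Field F] [AddCommGroup V] [Module F V] [AddCommGroup W] [Module F W]

/-- A subset `C` of `W × W` whose linear symmetries are exactly the monomial maps. -/
def HasMonomialSymmetries (F : Type*) {W : Type*} [Field F] [AddCommGroup W] [Module F W]
    (C : W × W → Prop) : Prop :=
  ∀ φ : (W × W) ≃ₗ[F] W × W, (∀ z, C (φ z) ↔ C z) ↔ IsMonomialAffine F φ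

/-- The group contains the translations, so the digraph is a Cayley digraph. Its linear
automorphisms are the linear maps preserving the out- or in-neighbourhood of `0`; the set of `z`
with an arc to `0` is used. -/
theorem IsDigraphAut.exists_connection_set {e : Module.Basis (Fin 2) F V}
    (h : IsDigraphAut (affineGroupG e W)) :
    ∃ C : W × W → Prop, HasMonomialSymmetries F C := by
  obtain ⟨Γ, -, hΓ⟩ := h
  let R : W × W → W × W → Prop := fun z z' =>
    Γ.Adj ((tensorCoord e).symm z) ((tensorCoord e).symm z')
  have hR (φ : Equiv.Perm (W × W)) :
      (∀ z z', R (φ z) (φ z') ↔ R z z') ↔ IsMonomialAffine F φ := by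
    let σ : Equiv.Perm (V ⊗[F] W) :=
      (tensorCoord e).toEquiv.trans (φ.trans (tensorCoord e).symm.toEquiv)
    have hσ := mem_affineGroupG_iff e σ
    have hσφ : (fun z => tensorCoord e (σ ((tensorCoord e).symm z))) = φ := by
      ext z <;> simp [σ]
    rw [hσφ, ← hΓ] at hσ
    rw [← hσ]
    constructor
    · intro h x y
      simpa [R, σ] using h (tensorCoord e x) (tensorCoord e y)
    · intro h z z'
      simpa [R, σ] using h ((tensorCoord e).symm z) ((tensorCoord e).symm z')
  have htrans (z z' : W × W) : R z z' ↔ R (z - z') 0 := by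
    have h := (hR (Equiv.subRight z')).2
      ⟨LinearEquiv.refl F W, 1, -z', Or.inl rfl, Or.inl fun x y => by
        simp [sub_eq_add_neg]⟩ z z'
    simpa using h.symm
  refine ⟨fun z => R z 0, fun φ => ?_⟩
  rw [← LinearEquiv.coe_toEquiv, ← hR]
  constructor
  · intro h z z'
    rw [htrans, htrans z]
    simpa [← map_sub] using h (z - z')
  · intro h z
    simpa using h z 0

namespace HasMonomialSymmetries

variable {C : W × W → Prop}

theorem map_iff (hC : HasMonomialSymmetries F C) (g : W ≃ₗ[F] W) (x y : W) :
    C (g x, g y) ↔ C (x, y) :=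
  (hC (g.prodCongr g)).2 ⟨g, 1, 0, Or.inl rfl, Or.inl fun x y => by simp⟩ (x, y)

theorem swap_iff (hC : HasMonomialSymmetries F C) (x y : W) : C (y, x) ↔ C (x, y) :=
  (hC (LinearEquiv.prodComm F W W)).2
    ⟨LinearEquiv.refl F W, 1, 0, Or.inl rfl, Or.inr fun x y => by simp⟩ (x, y)

theorem neg_iff (hC : HasMonomialSymmetries F C) (x y : W) : C (x, -y) ↔ C (x, y) :=
  (hC ((LinearEquiv.refl F W).prodCongr (LinearEquiv.neg F))).2
    ⟨LinearEquiv.refl F W, -1, 0, Or.inr rfl, Or.inl fun x y => by simp⟩ (x, y)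

/-- `GL(W)` is transitive on ordered independent pairs, so tensors of rank two are all inside or all
outside `C`. -/
theorem iff_of_linearIndependent [FiniteDimensional F W] (hC : HasMonomialSymmetries F C)
    {x y x' y' : W} (h : LinearIndependent F ![x, y]) (h' : LinearIndependent F ![x', y']) :
    C (x', y') ↔ C (x, y) := by
  obtain ⟨g, hg⟩ := exists_linearEquiv_of_linearIndependent h h'
  rw [← hC.map_iff g x y, show g x = x' from hg 0, show g y = y' from hg 1]

theorem smul_iff [FiniteDimensional F W] (hC : HasMonomialSymmetries F C) {w w' : W}
    (hw : w ≠ 0) (hw' : w' ≠ 0) (a b : F) : C (a • w', b • w') ↔ C (a • w, b • w) := by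
  have h : LinearIndependent F ![w] := linearIndependent_unique_iff.2 (by simpa using hw)
  have h' : LinearIndependent F ![w'] := linearIndependent_unique_iff.2 (by simpa using hw')
  obtain ⟨g, hg⟩ := exists_linearEquiv_of_linearIndependent h h'
  have hg0 : g w = w' := hg 0
  rw [← hC.map_iff g (a • w), map_smul, map_smul, hg0]

end HasMonomialSymmetries

theorem linearIndependent_pair_or_exists_smul (x y : W) :
    LinearIndependent F ![x, y] ∨ ∃ (w : W) (a b : F), x = a • w ∧ y = b • w := by
  by_cases hx : x = 0
  · exact Or.inr ⟨y, 0, 1, by simp [hx], by simp⟩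
  by_cases h : ∃ a : F, a • x = y
  · obtain ⟨a, ha⟩ := h
    exact Or.inr ⟨x, 1, a, by simp, ha.symm⟩
  · push Not at h
    exact Or.inl ((LinearIndependent.pair_iff' hx).2 h)

/-- The linear map `M ⊗ 1` for an invertible matrix `M = !![a, b; c, d]`. -/
theorem exists_matrix_equiv {a b c d : F} (hdet : a * d - b * c ≠ 0) :
    ∃ φ : (W × W) ≃ₗ[F] W × W, ∀ x y, φ (x, y) = (a • x + b • y, c • x + d • y) := by
  have hinv : (a * d - b * c)⁻¹ * (a * d - b * c) = 1 := inv_mul_cancel₀ hdet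
  refine ⟨{
    toFun := fun z => (a • z.1 + b • z.2, c • z.1 + d • z.2)
    map_add' := fun z z' => by
      ext <;> simp only [Prod.fst_add, Prod.snd_add] <;> module
    map_smul' := fun k z => by
      ext <;> simp only [Prod.smul_fst, Prod.smul_snd, RingHom.id_apply] <;> module
    invFun := fun z => ((a * d - b * c)⁻¹ • (d • z.1 - b • z.2),
      (a * d - b * c)⁻¹ • (a • z.2 - c • z.1))
    left_inv := fun z => by
      ext
      · linear_combination (norm := module) hinv • z.1
      · linear_combination (norm := module) hinv • z.2
    right_inv := fun z => by
      ext
      · linear_combination (norm := module) hinv • z.1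
      · linear_combination (norm := module) hinv • z.2 }, fun x y => rfl⟩

theorem linearIndependent_pair_matrix {a b c d : F} (hdet : a * d - b * c ≠ 0) {x y : W}
    (h : LinearIndependent F ![x, y]) :
    LinearIndependent F ![a • x + b • y, c • x + d • y] := by
  rw [LinearIndependent.pair_iff] at h ⊢
  intro s t hst
  obtain ⟨h1, h2⟩ := h (s * a + t * c) (s * b + t * d)
    (by linear_combination (norm := module) hst)
  have hs : (a * d - b * c) * s = 0 := by linear_combination d * h1 - c * h2
  have ht : (a * d - b * c) * t = 0 := by linear_combination a * h2 - b * h1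
  exact ⟨(mul_eq_zero.1 hs).resolve_left hdet, (mul_eq_zero.1 ht).resolve_left hdet⟩

/-- A matrix that preserves the rank one part of a set with monomial symmetries only is
monomial. -/
theorem HasMonomialSymmetries.isMonomialMatrix [FiniteDimensional F W] {C : W × W → Prop}
    (hC : HasMonomialSymmetries F C) {w : W} (hw : w ≠ 0) {a b c d : F}
    (hdet : a * d - b * c ≠ 0)
    (h : ∀ x y : F, C ((a * x + b * y) • w, (c * x + d * y) • w) ↔ C (x • w, y • w)) :
    IsMonomialMatrix a b c d := by
  obtain ⟨φ, hφ⟩ := exists_matrix_equiv (W := W) hdet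
  have hmono : IsMonomialAffine F φ := by
    rw [← hC]
    rintro ⟨x, y⟩
    rw [hφ]
    -- `M ⊗ 1` preserves rank; on rank two `C` is constant, and on rank one `h` applies.
    rcases linearIndependent_pair_or_exists_smul (F := F) x y with hxy | ⟨v, s, t, rfl, rfl⟩
    · exact hC.iff_of_linearIndependent hxy (linearIndependent_pair_matrix hdet hxy)
    · by_cases hv : v = 0
      · simp [hv]
      · rw [smul_smul, smul_smul, smul_smul, smul_smul, ← add_smul, ← add_smul,
          hC.smul_iff hw hv, h, hC.smul_iff hw hv]
  obtain ⟨g, ε, q, hε, hg⟩ := hmono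
  have hq : q = 0 := by
    have h0 : φ (0, 0) = 0 := map_zero φ
    rcases hg with hg | hg <;> simpa [h0, ← Prod.zero_eq_mk] using (hg 0 0).symm
  subst hq
  rcases hg with hg | hg
  · have h1 := hg w 0
    have h2 := hg 0 w
    simp only [hφ, smul_zero, add_zero, zero_add, map_zero, Prod.mk.injEq, smul_eq_zero, hw,
      or_false] at h1 h2
    refine Or.inl ⟨h2.1, h1.2, ?_⟩
    have h3 : (d - ε * a) • w = 0 := by
      rw [sub_smul, mul_smul, h1.1, h2.2, sub_self]
    have h4 := sub_eq_zero.1 ((smul_eq_zero_iff_left hw).1 h3)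
    rcases hε with rfl | rfl
    · exact Or.inl (by simpa using h4)
    · exact Or.inr (by simpa using h4)
  · have h1 := hg w 0
    have h2 := hg 0 w
    simp only [hφ, smul_zero, add_zero, zero_add, map_zero, Prod.mk.injEq, smul_eq_zero, hw,
      or_false] at h1 h2
    refine Or.inr ⟨h1.1, h2.2, ?_⟩
    have h3 : (c - ε * b) • w = 0 := by
      rw [sub_smul, mul_smul, h2.1, h1.2, sub_self]
    have h4 := sub_eq_zero.1 ((smul_eq_zero_iff_left hw).1 h3)
    rcases hε with rfl | rfl
    · exact Or.inl (by simpa using h4)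
    · exact Or.inr (by simpa using h4)

/-- There is no digraph if every colouring of the orbits of the monomial group on the projective
line is preserved by a matrix that is not monomial. -/
theorem not_isDigraphAut_of_colouring [FiniteDimensional F W] [Nontrivial W]
    (e : Module.Basis (Fin 2) F V) {ι : Type*} (cls : F → F → ι) (rep : ι → F)
    (hcls : ∀ x y, ¬(x = 0 ∧ y = 0) → ∃ k, k ≠ 0 ∧
      (x = k ∧ y = k * rep (cls x y) ∨ x = k ∧ y = -(k * rep (cls x y)) ∨
        x = k * rep (cls x y) ∧ y = k ∨ x = -(k * rep (cls x y)) ∧ y = k))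
    (hM : ∀ χ : ι → Bool, ∃ a b c d : F, a * d - b * c ≠ 0 ∧ ¬ IsMonomialMatrix a b c d ∧
      ∀ x y, ¬(x = 0 ∧ y = 0) →
        χ (cls (a * x + b * y) (c * x + d * y)) = χ (cls x y)) :
    ¬ IsDigraphAut (affineGroupG e W) := by
  classical
  intro h
  obtain ⟨C, hC⟩ := h.exists_connection_set
  obtain ⟨w, hw⟩ := exists_ne (0 : W)
  have hrep (x y : F) (hxy : ¬(x = 0 ∧ y = 0)) :
      C (x • w, y • w) ↔ C (w, rep (cls x y) • w) := by
    obtain ⟨k, hk, h⟩ := hcls x y hxy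
    have hk' : k • w ≠ 0 := smul_ne_zero hk hw
    have key (r : F) : C (k • w, (k * r) • w) ↔ C (w, r • w) := by
      simpa [smul_smul, mul_comm r k] using hC.smul_iff hw hk' 1 r
    generalize rep (cls x y) = r at h ⊢
    rcases h with ⟨rfl, rfl⟩ | ⟨rfl, rfl⟩ | ⟨rfl, rfl⟩ | ⟨rfl, rfl⟩
    · exact key r
    · rw [neg_smul, hC.neg_iff, key]
    · rw [hC.swap_iff, key]
    · rw [hC.swap_iff, neg_smul, hC.neg_iff, key]
  obtain ⟨a, b, c, d, hdet, hmono, hχ⟩ := hM fun i => decide (C (w, rep i • w))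
  refine hmono (hC.isMonomialMatrix hw hdet fun x y => ?_)
  by_cases hxy : x = 0 ∧ y = 0
  · simp [hxy.1, hxy.2]
  · have hxy' : ¬(a * x + b * y = 0 ∧ c * x + d * y = 0) := by
      rintro ⟨h1, h2⟩
      refine hxy ⟨?_, ?_⟩
      · have : (a * d - b * c) * x = 0 := by linear_combination d * h1 - b * h2
        exact (mul_eq_zero.1 this).resolve_left hdet
      · have : (a * d - b * c) * y = 0 := by linear_combination a * h2 - c * h1
        exact (mul_eq_zero.1 this).resolve_left hdet
    rw [hrep _ _ hxy', hrep _ _ hxy]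
    exact decide_eq_decide.1 (hχ x y hxy)

end Invariant

/-! ### The primes 5, 7 and 13 -/

section SmallPrimes

/-- The orbit of the line spanned by `(x, y)` over the fields of order `5` and `7`. -/
def orbitClass {R : Type*} [CommRing R] [DecidableEq R] (x y : R) : Fin 3 :=
  if x * y = 0 then 0 else if x ^ 2 = y ^ 2 then 1 else 2

/-- The orbit of the line spanned by `(x, y)` over the field of order `13`. -/
def orbitClassThirteen (x y : ZMod 13) : Fin 5 :=
  if x * y = 0 then 0 else if x ^ 2 = y ^ 2 then 1 else if x ^ 2 + y ^ 2 = 0 then 2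
  else if (x ^ 2 - 4 * y ^ 2) * (4 * x ^ 2 - y ^ 2) = 0 then 3 else 4

/-- The matrix `!![a, b; c, d]` is invertible and not monomial, and preserves the colouring. -/
def PreservesColouring {R ι : Type*} [CommRing R] (cls : R → R → ι) (χ : ι → Bool)
    (M : R × R × R × R) : Prop :=
  M.1 * M.2.2.2 - M.2.1 * M.2.2.1 ≠ 0 ∧
    ¬ ((M.2.1 = 0 ∧ M.2.2.1 = 0 ∧ (M.2.2.2 = M.1 ∨ M.2.2.2 = -M.1)) ∨
      (M.1 = 0 ∧ M.2.2.2 = 0 ∧ (M.2.2.1 = M.2.1 ∨ M.2.2.1 = -M.2.1))) ∧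
    ∀ x y, ¬(x = 0 ∧ y = 0) →
      χ (cls (M.1 * x + M.2.1 * y) (M.2.2.1 * x + M.2.2.2 * y)) = χ (cls x y)

/-- The point `(x, y)` spans a line in the orbit of the line spanned by `(1, r)`. -/
def IsInOrbit {R : Type*} [CommRing R] (x y r : R) : Prop :=
  ∃ k, k ≠ 0 ∧ (x = k ∧ y = k * r ∨ x = k ∧ y = -(k * r) ∨ x = k * r ∧ y = k ∨
    x = -(k * r) ∧ y = k)

instance {R ι : Type*} [CommRing R] [Fintype R] [DecidableEq R] (cls : R → R → ι) (χ : ι → Bool)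
    (M : R × R × R × R) : Decidable (PreservesColouring cls χ M) := by
  unfold PreservesColouring; infer_instance

instance {R : Type*} [CommRing R] [Fintype R] [DecidableEq R] (x y r : R) :
    Decidable (IsInOrbit x y r) := by
  unfold IsInOrbit; infer_instance

theorem isInOrbit_five : ∀ x y : ZMod 5, ¬(x = 0 ∧ y = 0) →
    IsInOrbit x y ((![0, 1, 2] : Fin 3 → ZMod 5) (orbitClass x y)) := by
  decide

set_option maxRecDepth 100000 in
theorem isInOrbit_seven : ∀ x y : ZMod 7, ¬(x = 0 ∧ y = 0) →
    IsInOrbit x y ((![0, 1, 2] : Fin 3 → ZMod 7) (orbitClass x y)) := by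
  decide

set_option maxRecDepth 100000 in
theorem isInOrbit_thirteen : ∀ x y : ZMod 13, ¬(x = 0 ∧ y = 0) →
    IsInOrbit x y ((![0, 1, 5, 2, 3] : Fin 5 → ZMod 13) (orbitClassThirteen x y)) := by
  decide

-- Each listed matrix leaves one of the three orbits invariant and mixes the other two. Two of the
-- three orbits share a colour. The same three matrices, with `4` and `6` both standing for `-1`,
-- work for 7.
set_option maxRecDepth 100000 in
theorem exists_preservesColouring_five : ∀ q₀ q₁ q₂ : Bool,
    ∃ M ∈ ([(1, 0, 0, 2), (1, 1, 1, 4), (1, 2, 2, 1)] : List (ZMod 5 × ZMod 5 × ZMod 5 × ZMod 5)),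
      PreservesColouring orbitClass ![q₀, q₁, q₂] M := by
  decide

set_option maxRecDepth 100000 in
theorem exists_preservesColouring_seven : ∀ q₀ q₁ q₂ : Bool,
    ∃ M ∈ ([(1, 0, 0, 2), (1, 1, 1, 6), (1, 2, 2, 1)] : List (ZMod 7 × ZMod 7 × ZMod 7 × ZMod 7)),
      PreservesColouring orbitClass ![q₀, q₁, q₂] M := by
  decide

-- With five orbits the pigeonhole no longer suffices. For instance `diag(1, 3)` needs equal colours
-- on the orbits of 1 and 3 and on those of 2 and 5. The 32 colourings are checked.
set_option maxRecDepth 100000 in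
theorem exists_preservesColouring_thirteen : ∀ q₀ q₁ q₂ q₃ q₄ : Bool,
    ∃ M ∈ ([(1, 0, 0, 3), (1, 1, 1, 12), (1, 2, 2, 1), (1, 1, 5, 8), (1, 3, 3, 12), (1, 0, 0, 5),
        (1, 5, 5, 1)] : List (ZMod 13 × ZMod 13 × ZMod 13 × ZMod 13)),
      PreservesColouring orbitClassThirteen ![q₀, q₁, q₂, q₃, q₄] M := by
  decide

theorem not_isDigraphAut_five [Fact (Nat.Prime 5)] {V W : Type*} [AddCommGroup V]
    [Module (ZMod 5) V] [AddCommGroup W] [Module (ZMod 5) W] [FiniteDimensional (ZMod 5) W]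
    [Nontrivial W] (e : Module.Basis (Fin 2) (ZMod 5) V) :
    ¬ IsDigraphAut (affineGroupG e W) := by
  refine not_isDigraphAut_of_colouring e orbitClass ![0, 1, 2] isInOrbit_five fun χ => ?_
  obtain ⟨M, -, hM⟩ := exists_preservesColouring_five (χ 0) (χ 1) (χ 2)
  have hχ : ![χ 0, χ 1, χ 2] = χ := by ext i; fin_cases i <;> rfl
  rw [hχ] at hM
  exact ⟨M.1, M.2.1, M.2.2.1, M.2.2.2, hM⟩

theorem not_isDigraphAut_seven [Fact (Nat.Prime 7)] {V W : Type*} [AddCommGroup V]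
    [Module (ZMod 7) V] [AddCommGroup W] [Module (ZMod 7) W] [FiniteDimensional (ZMod 7) W]
    [Nontrivial W] (e : Module.Basis (Fin 2) (ZMod 7) V) :
    ¬ IsDigraphAut (affineGroupG e W) := by
  refine not_isDigraphAut_of_colouring e orbitClass ![0, 1, 2] isInOrbit_seven fun χ => ?_
  obtain ⟨M, -, hM⟩ := exists_preservesColouring_seven (χ 0) (χ 1) (χ 2)
  have hχ : ![χ 0, χ 1, χ 2] = χ := by ext i; fin_cases i <;> rfl
  rw [hχ] at hM
  exact ⟨M.1, M.2.1, M.2.2.1, M.2.2.2, hM⟩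

theorem not_isDigraphAut_thirteen [Fact (Nat.Prime 13)] {V W : Type*} [AddCommGroup V]
    [Module (ZMod 13) V] [AddCommGroup W] [Module (ZMod 13) W] [FiniteDimensional (ZMod 13) W]
    [Nontrivial W] (e : Module.Basis (Fin 2) (ZMod 13) V) :
    ¬ IsDigraphAut (affineGroupG e W) := by
  refine not_isDigraphAut_of_colouring e orbitClassThirteen ![0, 1, 5, 2, 3] isInOrbit_thirteen
    fun χ => ?_
  obtain ⟨M, -, hM⟩ := exists_preservesColouring_thirteen (χ 0) (χ 1) (χ 2) (χ 3) (χ 4)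
  have hχ : ![χ 0, χ 1, χ 2, χ 3, χ 4] = χ := by ext i; fin_cases i <;> rfl
  rw [hχ] at hM
  exact ⟨M.1, M.2.1, M.2.2.1, M.2.2.2, hM⟩

end SmallPrimes

/-! ### The prime 3 -/

section Three

theorem eq_zero_or_eq_or_eq_neg_of_three : ∀ a b : ZMod 3, a = 0 ∨ b = 0 ∨ b = a ∨ b = -a := by
  decide

variable [Fact (Nat.Prime 3)] {V W : Type*} [AddCommGroup V] [Module (ZMod 3) V]
  [AddCommGroup W] [Module (ZMod 3) W]

theorem add_add_self_eq_zero (w : W) : w + w + w = 0 := by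
  have h : (3 : ZMod 3) = 0 := by rfl
  linear_combination (norm := module) h • w

theorem linearIndependent_pair_or_of_three (x y : W) :
    LinearIndependent (ZMod 3) ![x, y] ∨ x = 0 ∨ y = 0 ∨ y = x ∨ y = -x := by
  rcases linearIndependent_pair_or_exists_smul (F := ZMod 3) x y with h | ⟨w, a, b, rfl, rfl⟩
  · exact Or.inl h
  · rcases eq_zero_or_eq_or_eq_neg_of_three a b with rfl | rfl | rfl | rfl <;> simp

/-- The change of coordinates `(x, y) ↦ (x + y, x - y)` in characteristic three. -/
def sumDiffEquiv (W : Type*) [AddCommGroup W] [Module (ZMod 3) W] : (W × W) ≃ₗ[ZMod 3] W × W where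
  toFun z := (z.1 + z.2, z.1 - z.2)
  map_add' z z' := by ext <;> simp only [Prod.fst_add, Prod.snd_add] <;> abel
  map_smul' k z := by ext <;> simp [smul_add, smul_sub]
  invFun z := (-(z.1 + z.2), -(z.1 - z.2))
  left_inv z := by
    ext
    · change -(z.1 + z.2 + (z.1 - z.2)) = z.1
      linear_combination (norm := module) -add_add_self_eq_zero z.1
    · change -(z.1 + z.2 - (z.1 - z.2)) = z.2
      linear_combination (norm := module) -add_add_self_eq_zero z.2
  right_inv z := by
    ext
    · change -(z.1 + z.2) + -(z.1 - z.2) = z.1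
      linear_combination (norm := module) -add_add_self_eq_zero z.1
    · change -(z.1 + z.2) - -(z.1 - z.2) = z.2
      linear_combination (norm := module) -add_add_self_eq_zero z.2

/-- The map `(x, y) ↦ (x, g y)` is not monomial if `g` maps some vector to an independent one. -/
theorem not_isMonomialAffine_refl_prod {g : W ≃ₗ[ZMod 3] W} {w : W} (hw : w ≠ 0) (h1 : g w ≠ w)
    (h2 : g w ≠ -w) :
    ¬ IsMonomialAffine (ZMod 3) fun z : W × W => (z.1, g z.2) := by
  rintro ⟨f, ε, c, hε, h⟩
  have hc : c = 0 := by
    rcases h with h | h <;> simpa [← Prod.zero_eq_mk] using (h 0 0).symm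
  subst hc
  rcases h with h | h
  · have h3 := h w w
    simp only [add_zero, Prod.mk.injEq] at h3
    rw [← h3.1] at h3
    rcases hε with rfl | rfl
    · exact h1 (by simpa using h3.2)
    · exact h2 (by simpa using h3.2)
  · have h3 := h w 0
    simp [hw] at h3

/-- The image of `(w, 0)` is `(-(w + g w), -(w - g w))`, while a monomial linear map would make one
coordinate vanish. -/
theorem not_isMonomialAffine_sumDiff {g : W ≃ₗ[ZMod 3] W} {w : W} (h1 : g w ≠ w)
    (h2 : g w ≠ -w) :
    ¬ IsMonomialAffine (ZMod 3) (((sumDiffEquiv W).trans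
      ((LinearEquiv.refl (ZMod 3) W).prodCongr g)).trans (sumDiffEquiv W).symm) := by
  rintro ⟨f, ε, c, hε, h⟩
  have hc : c = 0 := by
    rcases h with h | h <;> simpa [← Prod.zero_eq_mk] using (h 0 0).symm
  subst hc
  have hw0 : ((sumDiffEquiv W).trans ((LinearEquiv.refl (ZMod 3) W).prodCongr g)).trans
      (sumDiffEquiv W).symm (w, 0) = (-(w + g w), -(w - g w)) := by
    simp [sumDiffEquiv]
  rcases h with h | h
  · have h3 := congrArg Prod.snd (hw0.symm.trans (h w 0))
    simp [sub_eq_zero] at h3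
    exact h1 h3
  · have h3 := congrArg Prod.fst (hw0.symm.trans (h w 0))
    simp only [map_zero, add_zero, neg_eq_zero] at h3
    exact h2 (eq_neg_of_add_eq_zero_right h3)

theorem not_isDigraphAut_three [FiniteDimensional (ZMod 3) W]
    (e : Module.Basis (Fin 2) (ZMod 3) V) {w w' : W} (hw : LinearIndependent (ZMod 3) ![w, w']) :
    ¬ IsDigraphAut (affineGroupG e W) := by
  intro h
  obtain ⟨C, hC⟩ := h.exists_connection_set
  have hw0 : w ≠ 0 := hw.ne_zero 0
  have hswap : LinearIndependent (ZMod 3) ![w', w] := by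
    have := hw
    rw [LinearIndependent.pair_iff] at this ⊢
    exact fun s t hst => (this t s (by rw [add_comm]; exact hst)).symm
  obtain ⟨g, hg⟩ := exists_linearEquiv_of_linearIndependent hw hswap
  have hgw : g w = w' := hg 0
  have h1 : g w ≠ w := by
    rw [hgw]
    intro h
    have := (LinearIndependent.pair_iff.1 hw) 1 (-1) (by simp [h])
    exact one_ne_zero this.1
  have h2 : g w ≠ -w := by
    rw [hgw]
    intro h
    have := (LinearIndependent.pair_iff.1 hw) 1 1 (by simp [h])
    exact one_ne_zero this.1
  have hA (x : W) (hx : x ≠ 0) : C (x, 0) ↔ C (w, 0) := by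
    simpa using hC.smul_iff hw0 hx 1 0
  have hA' (x : W) (hx : x ≠ 0) : C (0, x) ↔ C (w, 0) := by rw [hC.swap_iff, hA x hx]
  have hB (x : W) (hx : x ≠ 0) : C (x, x) ↔ C (w, w) := by
    simpa using hC.smul_iff hw0 hx 1 1
  have hB' (x : W) (hx : x ≠ 0) : C (x, -x) ↔ C (w, w) := by rw [hC.neg_iff, hB x hx]
  -- Nonzero tensors form three sets: the axes, the two diagonals, and rank two. Two of them agree
  -- about `C`.
  have hcases : (C (w, 0) ↔ C (w, w)) ∨ (C (w, w') ↔ C (w, w)) ∨ (C (w, w') ↔ C (w, 0)) := by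
    tauto
  rcases hcases with hAB | hκ | hκ
  · have hall (a b : ZMod 3) (hab : ¬(a = 0 ∧ b = 0)) : C (a • w, b • w) ↔ C (w, 0) := by
      by_cases ha0 : a = 0
      · rw [ha0, zero_smul, hA' _ (smul_ne_zero (fun hb => hab ⟨ha0, hb⟩) hw0)]
      have haw := smul_ne_zero ha0 hw0
      rcases eq_zero_or_eq_or_eq_neg_of_three a b with h | rfl | rfl | rfl
      · exact absurd h ha0
      · rw [zero_smul, hA _ haw]
      · rw [hB _ haw, hAB]
      · rw [neg_smul, hB' _ haw, hAB]
    -- `C` is constant on rank one, so even a shear preserves it.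
    have hmono := hC.isMonomialMatrix hw0 (a := 1) (b := 1) (c := 0) (d := 1) (by simp)
      fun x y => by
        by_cases hxy : x = 0 ∧ y = 0
        · simp [hxy.1, hxy.2]
        · rw [hall x y hxy, hall]
          rintro ⟨h3, h4⟩
          simp only [zero_mul, one_mul, zero_add] at h3 h4
          subst h4
          exact hxy ⟨by simpa using h3, rfl⟩
    simp [IsMonomialMatrix] at hmono
  · have hnz (x y : W) (hx : x ≠ 0) (hy : y ≠ 0) : C (x, y) ↔ C (w, w) := by
      rcases linearIndependent_pair_or_of_three x y with h | h | h | rfl | rfl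
      · rw [hC.iff_of_linearIndependent hw h, hκ]
      · exact absurd h hx
      · exact absurd h hy
      · exact hB _ hx
      · exact hB' _ hx
    -- Here `C` is constant on pairs of nonzero vectors and on each punctured axis, so `g` may act
    -- on the second coordinate alone.
    refine not_isMonomialAffine_refl_prod hw0 h1 h2
      ((hC ((LinearEquiv.refl (ZMod 3) W).prodCongr g)).1 ?_)
    rintro ⟨x, y⟩
    simp only [LinearEquiv.prodCongr_apply, LinearEquiv.refl_apply]
    by_cases hx : x = 0
    · subst hx
      simpa using hC.map_iff g 0 y
    by_cases hy : y = 0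
    · simp [hy]
    rw [hnz x y hx hy, hnz _ _ hx (by simpa using hy)]
  · have hne (x y : W) (hx : x ≠ y) (hy : x ≠ -y) : C (x, y) ↔ C (w, 0) := by
      rcases linearIndependent_pair_or_of_three x y with h | rfl | rfl | rfl | rfl
      · rw [hC.iff_of_linearIndependent hw h, hκ]
      · exact hA' _ hx.symm
      · exact hA _ hx
      · exact absurd rfl hx
      · exact absurd (neg_neg x).symm hy
    -- The coordinates `x + y`, `x - y` exchange axes and diagonals, which gives the previous case.
    refine not_isMonomialAffine_sumDiff h1 h2 ((hC _).1 ?_)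
    intro z
    set φ := ((sumDiffEquiv W).trans ((LinearEquiv.refl (ZMod 3) W).prodCongr g)).trans
      (sumDiffEquiv W).symm
    have hφ : sumDiffEquiv W (φ z) = (z.1 + z.2, g (z.1 - z.2)) := by
      simp only [φ, LinearEquiv.trans_apply, LinearEquiv.apply_symm_apply]
      rfl
    obtain ⟨x, y⟩ := z
    generalize φ (x, y) = z' at hφ
    obtain ⟨x', y'⟩ := z'
    change (x' + y', x' - y') = _ at hφ
    simp only [Prod.mk.injEq] at hφ
    obtain ⟨hs, hd⟩ := hφ
    have h3 : ∀ v : W, v + v = 0 → v = 0 := eq_zero_of_add_self_eq_zero (p := 3) (by decide)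
    by_cases hxy : x = y
    · subst hxy
      rw [sub_self, map_zero, sub_eq_zero] at hd
      subst hd
      have : x' = x := by
        rw [← sub_eq_zero]
        apply h3
        rw [← sub_eq_zero.2 hs]
        abel
      rw [this]
    by_cases hxy' : x = -y
    · subst hxy'
      have hy' : x' = -y' := eq_neg_of_add_eq_zero_left (by rw [hs]; simp)
      subst hy'
      have hy : y' = g y := by
        rw [← sub_eq_zero]
        apply h3
        rw [map_sub, map_neg, ← sub_eq_zero] at hd
        rw [← neg_eq_zero, ← hd]
        abel
      rw [hy, ← map_neg, hC.map_iff]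
    · rw [hne x y hxy hxy', hne]
      · rw [← sub_ne_zero, hd]
        simpa [sub_eq_zero] using hxy
      · rw [Ne, ← add_eq_zero_iff_eq_neg, hs, add_eq_zero_iff_eq_neg]
        exact hxy'

end Three

/-! ### Nonregularity and the main theorem -/

theorem not_isRegularPermGroup_affineGroupG {p : ℕ} [Fact p.Prime] {V W : Type*} [AddCommGroup V]
    [Module (ZMod p) V] [AddCommGroup W] [Module (ZMod p) W] [Nontrivial W] (hp : Odd p)
    (e : Module.Basis (Fin 2) (ZMod p) V) : ¬ IsRegularPermGroup (affineGroupG e W) := by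
  rintro ⟨-, h⟩
  obtain ⟨w, hw⟩ := exists_ne (0 : W)
  let σ : Equiv.Perm (V ⊗[ZMod p] W) := (LinearEquiv.neg (ZMod p)).toEquiv
  have hσ : σ ∈ affineGroupG e W := by
    rw [mem_affineGroupG_iff]
    exact ⟨LinearEquiv.neg (ZMod p), 1, 0, Or.inl rfl, Or.inl fun x y => by simp [σ]⟩
  have hmem : (⟨σ, hσ⟩ : affineGroupG e W) ∈ MulAction.stabilizer (affineGroupG e W)
      (0 : V ⊗[ZMod p] W) := by
    rw [MulAction.mem_stabilizer_iff]
    change σ 0 = 0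
    simp [σ]
  rw [h, Subgroup.mem_bot] at hmem
  have h1 : σ = 1 := congrArg Subtype.val hmem
  have h2 : σ ((tensorCoord e).symm (w, 0)) = (tensorCoord e).symm (w, 0) := by rw [h1]; rfl
  have h3 : -w = w := by
    have := congrArg (fun z => (tensorCoord e z).1) h2
    simpa [σ] using this
  exact hw (eq_zero_of_add_self_eq_zero hp w (by nth_rw 1 [← h3]; exact neg_add_cancel w))

theorem mainTheorem1 (m p : ℕ) (hm : 2 ≤ m) [Fact p.Prime] (hp : Odd p)
    {V W : Type*} [AddCommGroup V] [Module (ZMod p) V] [AddCommGroup W] [Module (ZMod p) W]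
    (e : Module.Basis (Fin 2) (ZMod p) V) (hW : Module.finrank (ZMod p) W = m) :
    (IsTwoClosed (affineGroupG e W) ∧ ¬ IsRegularPermGroup (affineGroupG e W) ∧
        ¬ IsDigraphAut (affineGroupG e W)) ↔
      p = 3 ∨ p = 5 ∨ p = 7 ∨ p = 13 := by
  have hfd : FiniteDimensional (ZMod p) W := Module.finite_of_finrank_pos (by omega)
  have hfin : Finite W := Module.finite_of_finite (ZMod p)
  have hnt : Nontrivial W := Module.nontrivial_of_finrank_pos (R := ZMod p) (by omega)
  have hcard : p ^ 2 ≤ Nat.card W := by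
    rw [Module.natCard_eq_pow_finrank (K := ZMod p), Nat.card_zmod, hW]
    exact Nat.pow_le_pow_right (Nat.Prime.pos Fact.out) hm
  constructor
  · rintro ⟨-, -, h⟩
    by_contra! hne
    exact h (isDigraphAut_affineGroupG hp hne.1 hne.2.1 hne.2.2.1 hne.2.2.2 e hcard)
  · intro h
    have hp3 : 3 ≤ p := by omega
    -- The net lemma with two classes needs `|W| > 2² + 2`, and `|W| ≥ p² ≥ 9`.
    refine ⟨isTwoClosed_affineGroupG hp (by nlinarith) e,
      not_isRegularPermGroup_affineGroupG hp e, ?_⟩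
    rcases h with rfl | rfl | rfl | rfl
    · have b := Module.finBasisOfFinrankEq (ZMod 3) W hW
      have hi : LinearIndependent (ZMod 3) (b ∘ ![⟨0, by omega⟩, ⟨1, by omega⟩]) :=
        b.linearIndependent.comp _ (by
          intro i j hij
          fin_cases i <;> fin_cases j <;> simp_all)
      refine not_isDigraphAut_three e (w := b ⟨0, by omega⟩) (w' := b ⟨1, by omega⟩) ?_
      convert hi using 1
      ext i
      fin_cases i <;> rfl
    · exact not_isDigraphAut_five e
    · exact not_isDigraphAut_seven e
    · exact not_isDigraphAut_thirteen e
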